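/- **Convergence of GoSare.** Setting. Let $N\ge 1$ and let $m_\ell,n_\ell,k_\ell$ be integers with $1\le k_\ell\le m_\ell n_\ell$ for $\ell=1,\dots,N$. Parameters $x\in\mathbb R^d$, $d=\sum_\ell m_\ell n_\ell$, are collections of weight matrices $X_\ell\in\mathbb R^{m_\ell\times n_\ell}$, with the Euclidean norm; $\nabla_\ell$ denotes the gradient with respect to $X_\ell$. Put $\underline\delta=\min_\ell \frac{k_\ell}{m_\ell n_\ell}$. Let $\mathcal D$ be a probability distribution of data $\xi$, $F(x;\xi)$ a loss that for each $x$ is $\mathcal D$-integrable and, for $\mathcal D$-almost every $\xi$, differentiable at $x$, with $\nabla F(x;\xi)$ jointly measurable, and let $f(x)=\mathbb E_{\xi\sim\mathcal D}F(x;\xi)$. Assume: 1. $\inf_x f(x)>-\infty$; 2. $f$ is differentiable and $\|\nabla f(x)-\nabla f(y)\|_2\le L\|x-y\|_2$ for all $x,y$, with $L>0$; 3. for all $x$ and $\ell$, $\mathbb E_\xi[\nabla_\ell F(x;\xi)]=\nabla_\ell f(x)$ and $\mathbb E_\xi\|\nabla_\ell F(x;\xi)-\nabla_\ell f(x)\|_F^2\le\sigma_\ell^2$,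 with $\sigma_\ell>0$. Put $\sigma=\sqrt{\sum_\ell\sigma_\ell^2}$. GoSare (small-batch stochastic gradients, momentum SGD) with parameters $\beta_1,\tau,\eta$ starts at a deterministic $x^{(0)}$ with $M_\ell^{(-1)}=0$. In iteration $t=0,1,2,\dots$ it draws $\xi^{(t)}\sim\mathcal D$ and sets $G_\ell^{(t)}=\nabla_\ell F(x^{(t)};\xi^{(t)})$; if $\tau\mid t$ it draws $S_\ell^{(t)}$ uniformly from the matrices in $\{0,1\}^{m_\ell\times n_\ell}$ with exactly $k_\ell$ ones, and otherwise $S_\ell^{(t)}=S_\ell^{(t-1)}$; then $$M_\ell^{(t)}=(1-\beta_1)S_\ell^{(t)}\odot M_\ell^{(t-1)}+\beta_1 S_\ell^{(t)}\odot G_\ell^{(t)},\qquad X_\ell^{(t+1)}=X_\ell^{(t)}-\eta\, S_\ell^{(t)}\odot M_\ell^{(t)}.$$ All draws are mutually independent. Let $\Delta=f(x^{(0)})-\inf_x f(x)$. Claims. There is a universal constant $C>0$ such that in every such setting the following holds. (a) If $$0<\beta_1\le 1,\quad \tau\ge\frac{64}{3\beta_1\underline\delta},\quad 0<\eta\le\min\left\{\frac1{4L},\sqrt{\frac{3\underline\delta\beta_1^2}{80L^2}},\sqrt{\frac{3\underline\delta}{80\tau^2L^2}},\sqrt{\frac{3\beta_1}{16\tau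 L^2}}\right\}$$ ($\tau$ an integer), then $\mathbb E\|\nabla f(x^{(t)})\|_2^2<\infty$ for all $t$, and for every $K\ge1$ $$\frac1{K\tau}\sum_{t=0}^{K\tau-1}\mathbb E\|\nabla f(x^{(t)})\|_2^2\le\frac{16\Delta}{\underline\delta\eta K\tau}+\frac{32\beta_1\sigma^2}{3\underline\delta}.$$ (b) Suppose $\Delta>0$, let $T$ be an integer with $T\ge 2+\frac{128}{3\underline\delta}+\frac{(128\sigma)^2}{9\sqrt{\underline\delta}L\Delta}$, and choose $$\beta_1=\left(1+\sqrt{\frac{\underline\delta^{3/2}\sigma^2T}{L\Delta}}\right)^{-1},\quad \tau=\left\lceil\frac{64}{3\underline\delta\beta_1}\right\rceil,\quad \eta=\left(4L+\sqrt{\frac{80L^2}{3\underline\delta\beta_1^2}}+\sqrt{\frac{80\tau^2L^2}{3\underline\delta}}+\sqrt{\frac{16\tau L^2}{3\beta_1}}\right)^{-1}.$$ Then $\mathbb E\|\nabla f(x^{(t)})\|_2^2<\infty$ for all $t$, and $$\frac1T\sum_{t=0}^{T-1}\mathbb E\|\nabla f(x^{(t)})\|_2^2\le C\left(\frac{L\Delta}{\underline\delta^{5/2}T}+\sqrt{\frac{L\Delta\sigma^2}{\underline\delta^{7/2}T}}\right).$$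 (c) Suppose $\Delta>0$. For every $\varepsilon>0$ there is an integer $T_0$ such that running GoSare for $T_0$ iterations, with the parameters of (b) for $T=T_0$, evaluates at most $$C\left(\frac{L\Delta\sigma^2}{\underline\delta^{7/2}\varepsilon^2}+\frac{L\Delta}{\underline\delta^{5/2}\varepsilon}+\frac{\sigma^2}{\underline\delta^{1/2}L\Delta}+\frac1{\underline\delta}\right)$$ stochastic gradients, and such that every integer $T\ge T_0$ satisfies the lower bound on $T$ in (b) and, with the parameters of (b) for this $T$, $\frac1T\sum_{t=0}^{T-1}\mathbb E\|\nabla f(x^{(t)})\|_2^2\le\varepsilon$; in particular $\mathbb E\|\nabla f(x^{(t)})\|_2^2\le\varepsilon$ for some $t<T$. -/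

import Mathlib

noncomputable section

namespace GoSare

open MeasureTheory ProbabilityTheory

/-- The squared Frobenius norm of a real matrix. -/
def frobSq {a b : ℕ} (A : Matrix (Fin a) (Fin b) ℝ) : ℝ :=
  ∑ i, ∑ j, A i j ^ 2

/-- The product (equivalently, Borel) `σ`-algebra on real matrices. -/
instance matrixMeasurableSpace (a b : ℕ) : MeasurableSpace (Matrix (Fin a) (Fin b) ℝ) :=
  inferInstanceAs (MeasurableSpace (Fin a → Fin b → ℝ))

/-- The set of `a × b` matrices with entries in `{0, 1}` having exactly `k` ones. -/
def sparseMasks (a b k : ℕ) : Set (Matrix (Fin a) (Fin b) ℝ) :=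
  {S | (∀ i j, S i j = 0 ∨ S i j = 1) ∧ frobSq S = k}

/-- One `m ℓ × n ℓ` real matrix for every layer `ℓ`. -/
abbrev Layers {N : ℕ} (m n : Fin N → ℕ) : Type :=
  (ℓ : Fin N) → Matrix (Fin (m ℓ)) (Fin (n ℓ)) ℝ

/-- The parameter space `ℝ^d`, `d = ∑ ℓ, m ℓ * n ℓ`, with the Euclidean norm; coordinates are
indexed by a layer and an entry of the weight matrix of that layer. -/
abbrev Params {N : ℕ} (m n : Fin N → ℕ) : Type :=
  EuclideanSpace ℝ ((ℓ : Fin N) × (Fin (m ℓ) × Fin (n ℓ)))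

section Setting

variable {N : ℕ} {m n : Fin N → ℕ} {Ξ : Type*}

/-- The weight matrix of layer `ℓ` of a parameter vector. -/
def layer (x : Params m n) (ℓ : Fin N) : Matrix (Fin (m ℓ)) (Fin (n ℓ)) ℝ :=
  Matrix.of fun i j => x ⟨ℓ, (i, j)⟩

/-- The parameter vector that collects all weight matrices. -/
def vec (X : Layers m n) : Params m n :=
  WithLp.toLp 2 fun p => X p.1 p.2.1 p.2.2

/-- `∇_ℓ g (x)`, the gradient with respect to the weight matrix of layer `ℓ`. -/
def layerGrad (g : Params m n → ℝ) (x : Params m n) (ℓ : Fin N) :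
    Matrix (Fin (m ℓ)) (Fin (n ℓ)) ℝ :=
  layer (gradient g x) ℓ

/-- The smallest density `k ℓ / (m ℓ * n ℓ)` over the layers. -/
def minDensity (m n k : Fin N → ℕ) : ℝ :=
  ⨅ ℓ, (k ℓ : ℝ) / ((m ℓ : ℝ) * (n ℓ : ℝ))

/-- The total noise level `√(∑ ℓ, σ ℓ ^ 2)`. -/
def totalNoise (σ : Fin N → ℝ) : ℝ :=
  √(∑ ℓ, σ ℓ ^ 2)

/-- The objective `f(x) = 𝔼_{ξ ∼ D} F(x; ξ)`. -/
def objective [MeasurableSpace Ξ] (F : Params m n → Ξ → ℝ) (D : Measure Ξ) (x : Params m n) : ℝ :=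
  ∫ s, F x s ∂D

/-- The initial gap `Δ = f(x₀) - inf f`. -/
def gap (f : Params m n → ℝ) (x₀ : Params m n) : ℝ :=
  f x₀ - ⨅ x, f x

/-- `f` is differentiable and its gradient is `L`-Lipschitz for the Euclidean norm. -/
structure LSmooth (f : Params m n → ℝ) (L : ℝ) : Prop where
  differentiable : Differentiable ℝ f
  lipschitz : ∀ x y, ‖gradient f x - gradient f y‖ ≤ L * ‖x - y‖

/-- `F` is a loss with a well-defined mean, and its sample gradients are well-defined
measurable random vectors. -/
structure IsLoss [MeasurableSpace Ξ] (F : Params m n → Ξ → ℝ) (D : Measure Ξ) : Prop where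
  integrable : ∀ x, Integrable (F x) D
  differentiableAt : ∀ x, ∀ᵐ s ∂D, DifferentiableAt ℝ (fun y => F y s) x
  measurable_gradient :
    Measurable fun p : Params m n × Ξ => gradient (fun y => F y p.2) p.1

/-- The stochastic gradients `∇_ℓ F(x; ξ)`, `ξ ∼ D`, are unbiased, with variance at most
`σ ℓ ^ 2` in layer `ℓ`. -/
structure StochasticGradient [MeasurableSpace Ξ] (F : Params m n → Ξ → ℝ) (D : Measure Ξ)
    (σ : Fin N → ℝ) : Prop where
  sigma_pos : ∀ ℓ, 0 < σ ℓ
  integrable : ∀ x ℓ i j, Integrable (fun s => layerGrad (fun y => F y s) x ℓ i j) D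
  unbiased : ∀ x ℓ i j,
    ∫ s, layerGrad (fun y => F y s) x ℓ i j ∂D = layerGrad (objective F D) x ℓ i j
  integrable_sq : ∀ x ℓ, Integrable
    (fun s => frobSq (layerGrad (fun y => F y s) x ℓ - layerGrad (objective F D) x ℓ)) D
  variance_le : ∀ x ℓ,
    ∫ s, frobSq (layerGrad (fun y => F y s) x ℓ - layerGrad (objective F D) x ℓ) ∂D ≤ σ ℓ ^ 2

/-- The state of the algorithm at the beginning of iteration `t`: the iterate `x^(t)`, the
momenta `M_ℓ^(t-1)`, the masks `S_ℓ^(t-1)`, and the number of stochastic gradients `∇F(x; ξ)`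
evaluated so far. -/
structure State (m n : Fin N → ℕ) where
  /-- the current iterate -/
  x : Params m n
  /-- the momentum of every layer -/
  M : Layers m n
  /-- the mask of every layer -/
  S : Layers m n
  /-- the number of stochastic gradient evaluations -/
  calls : ℕ

/-- One iteration, number `t`, of GoSare with small-batch stochastic gradients and MSGD.
`s` is the data sample of this iteration, and `newMasks` are the masks that are installed if
`t ≡ 0 (mod τ)`. -/
def step (F : Params m n → Ξ → ℝ) (β : ℝ) (τ : ℕ) (η : ℝ) (t : ℕ) (s : Ξ) (newMasks : Layers m n)
    (st : State m n) : State m n :=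
  let G : Layers m n := fun ℓ => layerGrad (fun y => F y s) st.x ℓ
  let S : Layers m n := if t % τ = 0 then newMasks else st.S
  let R : Layers m n := fun ℓ => (S ℓ).hadamard (G ℓ)
  let M : Layers m n := fun ℓ => (1 - β) • (S ℓ).hadamard (st.M ℓ) + β • R ℓ
  { x := vec fun ℓ => layer st.x ℓ - η • (S ℓ).hadamard (M ℓ)
    M := M
    S := S
    calls := st.calls + 1 }

/-- The state after `t` iterations, for given data samples `ξ t` (one per iteration) and given
mask draws `U j` (the draw `U j` is used at iteration `j * τ`). The momenta start at zero; the
initial value of the masks is irrelevant, since iteration `0` installs new masks. -/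
def run (F : Params m n → Ξ → ℝ) (β : ℝ) (τ : ℕ) (η : ℝ) (x₀ : Params m n)
    (ξ : ℕ → Ξ) (U : ℕ → Layers m n) : ℕ → State m n
  | 0 => { x := x₀, M := fun _ => 0, S := fun _ => 0, calls := 0 }
  | t + 1 => step F β τ η t (ξ t) (U (t / τ)) (run F β τ η x₀ ξ U t)

variable {Ω : Type*}

/-- The randomness of GoSare on a probability space `(Ω, μ)`: data samples `ξ t ∼ D` and masks
`U j ℓ` uniform on the `k ℓ`-sparse masks of layer `ℓ`, all of them mutually independent. -/
structure IsSampling [MeasurableSpace Ξ] [MeasurableSpace Ω] (D : Measure Ξ) (k : Fin N → ℕ)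
    (μ : Measure Ω) (ξ : ℕ → Ω → Ξ)
    (U : ℕ → (ℓ : Fin N) → Ω → Matrix (Fin (m ℓ)) (Fin (n ℓ)) ℝ) : Prop where
  measurable_data : ∀ t, Measurable (ξ t)
  measurable_mask : ∀ j ℓ, Measurable (U j ℓ)
  law_data : ∀ t, μ.map (ξ t) = D
  law_mask : ∀ j ℓ, μ.map (U j ℓ) = uniformOn (sparseMasks (m ℓ) (n ℓ) (k ℓ))
  indep : iIndep (fun i : ℕ ⊕ (ℕ × Fin N) =>
    Sum.elim (fun t => MeasurableSpace.comap (ξ t) inferInstance)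
      (fun p => MeasurableSpace.comap (U p.1 p.2) inferInstance) i) μ

/-- The random state of GoSare after `t` iterations. -/
def process (F : Params m n → Ξ → ℝ) (β : ℝ) (τ : ℕ) (η : ℝ) (x₀ : Params m n)
    (ξ : ℕ → Ω → Ξ) (U : ℕ → (ℓ : Fin N) → Ω → Matrix (Fin (m ℓ)) (Fin (n ℓ)) ℝ)
    (t : ℕ) (ω : Ω) : State m n :=
  run F β τ η x₀ (fun t' => ξ t' ω) (fun j ℓ => U j ℓ ω) t

/-- The random variable `‖∇f(x^(t))‖²`, where `x^(t)` is the iterate of GoSare. -/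
def gradSq [MeasurableSpace Ξ] (F : Params m n → Ξ → ℝ) (D : Measure Ξ)
    (x₀ : Params m n) (ξ : ℕ → Ω → Ξ)
    (U : ℕ → (ℓ : Fin N) → Ω → Matrix (Fin (m ℓ)) (Fin (n ℓ)) ℝ)
    (β : ℝ) (τ : ℕ) (η : ℝ) (t : ℕ) (ω : Ω) : ℝ :=
  ‖gradient (objective F D) (process F β τ η x₀ ξ U t ω).x‖ ^ 2

end Setting

/-- The smallest admissible number of iterations for the tuned hyperparameters
(`δ` minimal density, `σ` total noise level, `L` smoothness constant, `Δ` initial gap). -/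
def minIterations (δ σ L Δ : ℝ) : ℝ :=
  2 + 128 / (3 * δ) + (128 * σ) ^ 2 / (9 * √δ * L * Δ)

/-- The tuned momentum parameter. -/
def tunedBeta (δ σ L Δ : ℝ) (T : ℕ) : ℝ :=
  (1 + √(δ ^ (3 / 2 : ℝ) * σ ^ 2 * T / (L * Δ)))⁻¹

/-- The tuned period of mask changes. -/
def tunedTau (δ σ L Δ : ℝ) (T : ℕ) : ℕ :=
  ⌈64 / (3 * δ * tunedBeta δ σ L Δ T)⌉₊

/-- The tuned learning rate. -/
def tunedEta (δ σ L Δ : ℝ) (T : ℕ) : ℝ :=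
  (4 * L + √(80 * L ^ 2 / (3 * δ * tunedBeta δ σ L Δ T ^ 2))
    + √(80 * (tunedTau δ σ L Δ T : ℝ) ^ 2 * L ^ 2 / (3 * δ))
    + √(16 * (tunedTau δ σ L Δ T : ℝ) * L ^ 2 / (3 * tunedBeta δ σ L Δ T)))⁻¹

end GoSare

end

/-! ### Scalar energy argument -/

namespace GoSare

/-! Let g be the gradient of f at the iterate, S the mask in force, M the updated momentum, v the
total variance and δ the minimal density. The argument follows a = E‖g‖², p = E‖S⊙g‖², q = E‖M‖² and
e = E‖S⊙g - M‖².

Smoothness and polarization show that one step lowers E f by at least η/2 * (p + (1 - L * η) * q -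
e) (`objective_succ`). The error e contracts by the factor 1 - β, up to L²η²q/β for the change of
the gradient and β²v for the fresh sample, which is independent of the state and hence centred given
the state (`error_succ`). A mask change exposes coordinates where the old momentum vanishes; this
adds at most one term a per period. After division by β these terms are a small multiple of δτ times
the sum of a over period starts, because τ ≥ 64/(3βδ).

Descent only sees the masked gradient. At a period start the mask is independent of the iterate and
its entries have mean at least δ, so p ≥ δa (`mask_grad_ge`). Later the iterate depends on the mask,
but the squared drift of g within a period is at most L²η²τ times the sum of ‖M‖² over that period,
and the q-term of the descent pays for it (`mask_grad_period`, `grad_period`). `sum_grad_le` adds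
everything up.

The algorithm is an instance of an abstract masked recursion on ℝ^d (`isMaskedMSGD`); its
independence properties hold because disjoint sets of draws generate independent σ-algebras. The
tuned rate then comes from balancing the optimization term against the noise term, and the
complexity from solving the rate for T. -/

/-- Splitting a sum over `K * τ` consecutive indices into `K` blocks of length `τ`. -/
lemma sum_range_mul_eq (h : ℕ → ℝ) (K τ : ℕ) :
    ∑ t ∈ Finset.range (K * τ), h t
      = ∑ j ∈ Finset.range K, ∑ r ∈ Finset.range τ, h (j * τ + r) := by
  induction K with
  | zero => simp
  | succ K ih =>
    rw [Finset.sum_range_succ, ← ih, add_mul, one_mul, Finset.sum_range_add]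

lemma sum_range_mul_dvd (h : ℕ → ℝ) (K τ : ℕ) (hτ : 0 < τ) :
    ∑ t ∈ Finset.range (K * τ), (if τ ∣ t then h t else 0)
      = ∑ j ∈ Finset.range K, h (j * τ) := by
  rw [sum_range_mul_eq]
  refine Finset.sum_congr rfl fun j _ => ?_
  rw [Finset.sum_eq_single_of_mem 0 (by simpa using hτ)]
  · simp
  · intro r hr hr0
    rw [if_neg]
    rw [Nat.dvd_add_right (Dvd.intro_left j rfl)]
    intro h
    exact absurd (Nat.le_of_dvd (Nat.pos_of_ne_zero hr0) h) (by simpa using hr)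

/-- Summing a perturbed geometric contraction. -/
lemma sum_contraction_le {β c v : ℝ} (e q b : ℕ → ℝ) (h0 : e 0 ≤ b 0 + v)
    (hs : ∀ t, e (t + 1) ≤ (1 - β) * e t + c * q t + v + b (t + 1)) (T : ℕ) :
    β * ∑ t ∈ Finset.range (T + 1), e t + (1 - β) * e T
      ≤ c * ∑ t ∈ Finset.range T, q t + (T + 1) * v + ∑ t ∈ Finset.range (T + 1), b t := by
  -- Keeping (1 - β) * e T on the left closes the induction: the next inequality trades exactly this
  -- leftover for e (T + 1).
  induction T with
  | zero => simp; linarith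
  | succ T ih =>
    rw [Finset.sum_range_succ e (T + 1), Finset.sum_range_succ b (T + 1),
      Finset.sum_range_succ q T]
    have := hs T
    push_cast
    linarith

/-- The final bookkeeping of the energy argument. -/
lemma le_of_energy {β δ η v G S A Q Pp Ee T : ℝ} (hδ : 0 < δ) (hδ1 : δ ≤ 1) (hη : 0 < η)
    (hT : 0 ≤ T * (β * v)) (hA0 : 0 ≤ A) (hQ0 : 0 ≤ Q)
    (h1 : Ee ≤ 3 * δ / 80 * Q + T * (β * v) + 3 * δ / 64 * A)
    (h2 : Pp + 3 / 4 * Q ≤ 2 * G / η + Ee) (h5 : δ / 2 * A - 3 * δ / 80 * Q ≤ Pp)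
    (h6 : S ≤ 2 * A + 2 * (3 * δ / 80 * Q)) :
    S ≤ 16 * G / (δ * η) + 32 * β * v / (3 * δ) * T := by
  have hδQ : δ * Q ≤ Q := mul_le_of_le_one_left hQ0 hδ1
  have hδQ2 : δ * (δ * Q) ≤ δ * Q := mul_le_mul_of_nonneg_left hδQ hδ.le
  have hδQ3 : 0 ≤ δ * Q := by positivity
  have hδA : 0 ≤ δ * A := by positivity
  have h7 := mul_le_mul_of_nonneg_left h6 hδ.le
  -- Here A carries the factor τ. After eliminating Pp and Ee, the left side retains (1/2 - 3/64) *
  -- δ * A and at least (3/4 - 6/80) * Q, more than the δ/4 * A and 3δ²/320 * Q contained in δ/8 *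
  -- S.
  have hfin : δ / 8 * S ≤ 2 * G / η + T * (β * v) := by linarith
  have h8 := mul_le_mul_of_nonneg_left hfin (show 0 ≤ 8 / δ by positivity)
  have h9 : 8 / δ * (δ / 8 * S) = S := by field_simp
  have h10 : 8 / δ * (2 * G / η) = 16 * G / (δ * η) := by field_simp; ring
  have h0 : 0 ≤ T * (β * v) / δ := by positivity
  have e1 : 8 / δ * (T * (β * v)) = 8 * (T * (β * v) / δ) := by ring
  have e2 : 32 * β * v / (3 * δ) * T = 32 / 3 * (T * (β * v) / δ) := by field_simp
  rw [mul_add, h9, h10, e1] at h8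
  linarith

/-- The energy argument: if the expected squared norms `a` of the gradients, `p` of the masked
gradients, `q` of the momenta and `e` of the momentum errors satisfy the one-step estimates, then
the average of `a` is small. -/
lemma sum_grad_le {β δ η L v φ₀ φinf : ℝ} {τ K : ℕ} (a p q e φ : ℕ → ℝ)
    (hβ : 0 < β) (hβ1 : β ≤ 1) (hδ : 0 < δ) (hδ1 : δ ≤ 1) (hη : 0 < η) (hL : 0 < L)
    (hv : 0 ≤ v) (hτ : 64 / (3 * β * δ) ≤ (τ : ℝ)) (hK : 1 ≤ K)
    (hη1 : L * η ≤ 1 / 4) (hη2 : L ^ 2 * η ^ 2 ≤ 3 * δ * β ^ 2 / 80)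
    (hη3 : L ^ 2 * η ^ 2 * τ ^ 2 ≤ 3 * δ / 80)
    (ha : ∀ t, 0 ≤ a t) (hq : ∀ t, 0 ≤ q t) (he : ∀ t, 0 ≤ e t)
    (he0 : e 0 ≤ a 0 + β ^ 2 * v)
    (hes : ∀ t, e (t + 1) ≤ (1 - β) * e t + L ^ 2 * η ^ 2 / β * q t + β ^ 2 * v
      + if τ ∣ t + 1 then a (t + 1) else 0)
    (hφ0 : φ 0 ≤ φ₀) (hφinf : ∀ t, φinf ≤ φ t)
    (hφ : ∀ t, φ (t + 1) ≤ φ t - η / 2 * p t - η / 2 * (1 - L * η) * q t + η / 2 * e t)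
    (hp : ∀ j, ∀ r < τ, δ / 2 * a (j * τ)
      - L ^ 2 * η ^ 2 * τ * ∑ s ∈ Finset.range τ, q (j * τ + s) ≤ p (j * τ + r))
    (hat : ∀ j, ∀ r < τ, a (j * τ + r) ≤ 2 * a (j * τ)
      + 2 * (L ^ 2 * η ^ 2 * τ * ∑ s ∈ Finset.range τ, q (j * τ + s))) :
    ∑ t ∈ Finset.range (K * τ), a t
      ≤ 16 * (φ₀ - φinf) / (δ * η) + 32 * β * v / (3 * δ) * (K * τ) := by
  have hτ0 : (0 : ℝ) < τ := lt_of_lt_of_le (by positivity) hτ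
  have hτn : 0 < τ := by exact_mod_cast hτ0
  set A := ∑ j ∈ Finset.range K, a (j * τ) with hA
  set Q := ∑ t ∈ Finset.range (K * τ), q t with hQ
  set S := ∑ t ∈ Finset.range (K * τ), a t with hS
  set Pp := ∑ t ∈ Finset.range (K * τ), p t with hPp
  set Ee := ∑ t ∈ Finset.range (K * τ), e t with hEe
  have hA0 : 0 ≤ A := Finset.sum_nonneg fun j _ => ha _
  have hQ0 : 0 ≤ Q := Finset.sum_nonneg fun j _ => hq _
  -- the momentum error
  have h1 : β * Ee ≤ L ^ 2 * η ^ 2 / β * Q + K * τ * (β ^ 2 * v) + A := by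
    obtain ⟨T, hT⟩ : ∃ T, K * τ = T + 1 :=
      ⟨K * τ - 1, (Nat.succ_pred_eq_of_pos (Nat.mul_pos hK hτn)).symm⟩
    have := sum_contraction_le (β := β) (c := L ^ 2 * η ^ 2 / β) (v := β ^ 2 * v) e q
      (fun t => if τ ∣ t then a t else 0) (by simpa using he0) hes T
    rw [← hT, sum_range_mul_dvd _ _ _ hτn, ← hEe, ← hA] at this
    have hle : ∑ t ∈ Finset.range T, q t ≤ Q := by
      rw [hQ, hT]
      exact Finset.sum_le_sum_of_subset_of_nonneg (Finset.range_mono (Nat.le_succ T))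
        fun _ _ _ => hq _
    have h2 : (1 - β) * e T ≥ 0 := mul_nonneg (by linarith) (he T)
    have h3 : L ^ 2 * η ^ 2 / β * ∑ t ∈ Finset.range T, q t ≤ L ^ 2 * η ^ 2 / β * Q := by
      gcongr
    have h4 : ((T : ℝ) + 1) = K * τ := by exact_mod_cast hT.symm
    rw [h4] at this
    linarith
  have h1' : Ee ≤ 3 * δ / 80 * Q + K * τ * (β * v) + 3 * δ / 64 * (τ * A) := by
    have h2 : β * Ee ≤ β * (3 * δ / 80 * Q + K * τ * (β * v) + 3 * δ / 64 * (τ * A)) := by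
      refine h1.trans ?_
      have h3 : L ^ 2 * η ^ 2 / β ≤ β * (3 * δ / 80) := by
        rw [div_le_iff₀ hβ]; linarith
      -- The lower bound on τ amortizes the mask changes: one term a per period, divided by β, costs
      -- at most 3δ/64 times τ such terms.
      have h4 : 1 ≤ β * (3 * δ / 64) * τ := by
        rw [div_le_iff₀ (by positivity)] at hτ; linarith
      nlinarith [mul_le_mul_of_nonneg_right h3 hQ0, mul_le_mul_of_nonneg_right h4 hA0]
    exact le_of_mul_le_mul_left h2 hβ
  -- descent
  have h2 : ∀ T, φ T ≤ φ 0 - η / 2 * ∑ t ∈ Finset.range T, p t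
      - η / 2 * (1 - L * η) * ∑ t ∈ Finset.range T, q t
      + η / 2 * ∑ t ∈ Finset.range T, e t := by
    intro T
    induction T with
    | zero => simp
    | succ T ih =>
      simp only [Finset.sum_range_succ]
      linarith [hφ T]
  have h2' : Pp + 3 / 4 * Q ≤ 2 * (φ₀ - φinf) / η + Ee := by
    have h3 := h2 (K * τ)
    have h4 := hφinf (K * τ)
    have h5 : η / 2 * (3 / 4) * Q ≤ η / 2 * (1 - L * η) * Q := by
      gcongr; linarith
    have h6 : Pp + 3 / 4 * Q - Ee ≤ 2 * (φ₀ - φinf) / η := by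
      rw [le_div_iff₀ hη]; nlinarith
    linarith
  -- drift inside a period
  have hdrift : ∑ j ∈ Finset.range K, ∑ r ∈ Finset.range τ,
      (L ^ 2 * η ^ 2 * τ * ∑ s ∈ Finset.range τ, q (j * τ + s)) ≤ 3 * δ / 80 * Q := by
    rw [hQ, sum_range_mul_eq, Finset.mul_sum]
    refine Finset.sum_le_sum fun j _ => ?_
    rw [Finset.sum_const, Finset.card_range, nsmul_eq_mul, ← mul_assoc]
    refine mul_le_mul_of_nonneg_right ?_ (Finset.sum_nonneg fun _ _ => hq _)
    linarith
  have h5 : δ / 2 * (τ * A) - 3 * δ / 80 * Q ≤ Pp := by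
    have : ∑ j ∈ Finset.range K, ∑ r ∈ Finset.range τ, (δ / 2 * a (j * τ)
      - L ^ 2 * η ^ 2 * τ * ∑ s ∈ Finset.range τ, q (j * τ + s)) ≤ Pp := by
      rw [hPp, sum_range_mul_eq]
      exact Finset.sum_le_sum fun j _ => Finset.sum_le_sum fun r hr => hp j r (by simpa using hr)
    simp only [Finset.sum_sub_distrib] at this
    have h6 : ∑ j ∈ Finset.range K, ∑ r ∈ Finset.range τ, δ / 2 * a (j * τ)
        = δ / 2 * (τ * A) := by
      simp only [Finset.sum_const, Finset.card_range, nsmul_eq_mul, hA, Finset.mul_sum]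
      exact Finset.sum_congr rfl fun _ _ => by ring
    linarith
  have h6 : S ≤ 2 * (τ * A) + 2 * (3 * δ / 80 * Q) := by
    have : S ≤ ∑ j ∈ Finset.range K, ∑ r ∈ Finset.range τ, (2 * a (j * τ)
      + 2 * (L ^ 2 * η ^ 2 * τ * ∑ s ∈ Finset.range τ, q (j * τ + s))) := by
      rw [hS, sum_range_mul_eq]
      exact Finset.sum_le_sum fun j _ => Finset.sum_le_sum fun r hr => hat j r (by simpa using hr)
    refine this.trans ?_
    generalize hD : (fun j => L ^ 2 * η ^ 2 * τ * ∑ s ∈ Finset.range τ, q (j * τ + s)) = D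
      at hdrift
    simp only [funext_iff] at hD
    simp only [hD, Finset.sum_const, Finset.card_range, nsmul_eq_mul, Finset.sum_add_distrib,
      mul_add] at hdrift ⊢
    have e1 : ∑ j ∈ Finset.range K, (τ : ℝ) * (2 * a (j * τ)) = 2 * (τ * A) := by
      rw [hA, Finset.mul_sum, Finset.mul_sum]
      exact Finset.sum_congr rfl fun _ _ => by ring
    have e2 : ∑ j ∈ Finset.range K, (τ : ℝ) * (2 * D j) = 2 * ∑ j ∈ Finset.range K, τ * D j := by
      rw [Finset.mul_sum]
      exact Finset.sum_congr rfl fun _ _ => by ring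
    linarith
  exact le_of_energy hδ hδ1 hη (by positivity) (by positivity) hQ0 h1' h2' h5 h6

end GoSare

/-! ### Tuned hyperparameters -/

namespace GoSare

/-- Turns the half-integer powers of δ into natural powers of √δ, for which the later estimates are
rational identities. -/
lemma rpow_half_eq {δ : ℝ} (hδ : 0 ≤ δ) (j : ℕ) : δ ^ ((j : ℝ) / 2) = √δ ^ j := by
  rw [Real.rpow_div_two_eq_sqrt _ hδ, Real.rpow_natCast]

lemma tunedBeta_pos_le {δ σ L Δ : ℝ} (T : ℕ) :
    0 < tunedBeta δ σ L Δ T ∧ tunedBeta δ σ L Δ T ≤ 1 := by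
  unfold tunedBeta
  have := Real.sqrt_nonneg (δ ^ (3 / 2 : ℝ) * σ ^ 2 * T / (L * Δ))
  exact ⟨by positivity, inv_le_one_of_one_le₀ (by linarith)⟩

lemma le_tunedTau {δ σ L Δ : ℝ} (T : ℕ) :
    64 / (3 * tunedBeta δ σ L Δ T * δ) ≤ (tunedTau δ σ L Δ T : ℝ) := by
  rw [mul_right_comm]
  exact Nat.le_ceil _

lemma tunedTau_le_add_one {δ σ L Δ : ℝ} (hδ : 0 < δ) (T : ℕ) :
    (tunedTau δ σ L Δ T : ℝ) ≤ 64 / (3 * δ * tunedBeta δ σ L Δ T) + 1 := by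
  have := (tunedBeta_pos_le (δ := δ) (σ := σ) (L := L) (Δ := Δ) T).1
  exact (Nat.ceil_lt_add_one (by positivity)).le

/-- The period is at most 64/(3δ) * (1 + r) + 1, where r is the square root in `tunedBeta`. The
first two terms of `minIterations` are twice 64/(3δ) + 1, and the σ-term makes the part with r at
most T/2. -/
lemma tunedTau_le {δ σ L Δ : ℝ} (hδ : 0 < δ) (hL : 0 < L)
    (hΔ : 0 < Δ) (T : ℕ) (hT : minIterations δ σ L Δ ≤ T) : tunedTau δ σ L Δ T ≤ T := by
  have h := tunedTau_le_add_one (σ := σ) (L := L) (Δ := Δ) hδ T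
  unfold tunedBeta at h
  have e3 : δ ^ (3 / 2 : ℝ) = √δ ^ 3 := by
    simpa using rpow_half_eq hδ.le 3
  rw [e3] at h
  unfold minIterations at hT
  have hs : 0 < √δ := Real.sqrt_pos.2 hδ
  have hss : √δ ^ 2 = δ := Real.sq_sqrt hδ.le
  set s := √δ
  have hT0 : (0 : ℝ) ≤ T := Nat.cast_nonneg T
  have hσ : (0 : ℝ) ≤ (128 * σ) ^ 2 / (9 * s * L * Δ) := by positivity
  have hδ' : 0 ≤ 128 / (3 * δ) := by positivity
  -- the square root part of the period
  have key : 64 / (3 * δ) * √(s ^ 3 * σ ^ 2 * T / (L * Δ)) ≤ T / 2 := by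
    rw [← le_div_iff₀' (by positivity)]
    apply Real.sqrt_le_iff.2 ⟨by positivity, ?_⟩
    have h1 : (128 * σ) ^ 2 / (9 * s * L * Δ) ≤ T := by linarith
    have h2 := mul_le_mul_of_nonneg_right h1 (show 0 ≤ 9 * s ^ 4 * T / 128 ^ 2 by positivity)
    have e1 : (128 * σ) ^ 2 / (9 * s * L * Δ) * (9 * s ^ 4 * T / 128 ^ 2)
        = s ^ 3 * σ ^ 2 * T / (L * Δ) := by
      field_simp
    have e2 : (T : ℝ) * (9 * s ^ 4 * T / 128 ^ 2) = (T / 2 / (64 / (3 * δ))) ^ 2 := by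
      rw [← hss]; field_simp; ring
    rw [e1, e2] at h2
    exact h2
  have e4 : 64 / (3 * δ * (1 + √(s ^ 3 * σ ^ 2 * T / (L * Δ)))⁻¹)
      = 64 / (3 * δ) + 64 / (3 * δ) * √(s ^ 3 * σ ^ 2 * T / (L * Δ)) := by
    rw [← div_div, div_inv_eq_mul]; ring
  have e5 : 128 / (3 * δ) = 2 * (64 / (3 * δ)) := by ring
  rw [e4] at h
  have : (tunedTau δ σ L Δ T : ℝ) ≤ T := by linarith
  exact_mod_cast this

lemma inv_le_sqrt_of_sqrt_inv_le {A x : ℝ} (hx : 0 < x) (hA : √(x⁻¹) ≤ A) : A⁻¹ ≤ √x := by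
  rw [Real.sqrt_inv] at hA
  exact inv_le_of_inv_le₀ (Real.sqrt_pos.2 hx) hA

/-- The step size is the reciprocal of a sum of positive terms, hence below the reciprocal of each
of them, and these reciprocals are the four upper bounds. -/
lemma tunedEta_le {δ σ L Δ : ℝ} (hδ : 0 < δ) (hL : 0 < L) (T : ℕ) :
    0 < tunedEta δ σ L Δ T ∧ tunedEta δ σ L Δ T ≤ 1 / (4 * L) ∧
    tunedEta δ σ L Δ T ≤ √(3 * δ * tunedBeta δ σ L Δ T ^ 2 / (80 * L ^ 2)) ∧
    tunedEta δ σ L Δ T ≤ √(3 * δ / (80 * (tunedTau δ σ L Δ T : ℝ) ^ 2 * L ^ 2)) ∧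
    tunedEta δ σ L Δ T
      ≤ √(3 * tunedBeta δ σ L Δ T / (16 * (tunedTau δ σ L Δ T : ℝ) * L ^ 2)) := by
  have hβ := (tunedBeta_pos_le (δ := δ) (σ := σ) (L := L) (Δ := Δ) T).1
  have hτ : 0 < (tunedTau δ σ L Δ T : ℝ) := lt_of_lt_of_le (by positivity) (le_tunedTau T)
  unfold tunedEta
  set β := tunedBeta δ σ L Δ T
  set τ := (tunedTau δ σ L Δ T : ℝ)
  have h1 := Real.sqrt_nonneg (80 * L ^ 2 / (3 * δ * β ^ 2))
  have h2 := Real.sqrt_nonneg (80 * τ ^ 2 * L ^ 2 / (3 * δ))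
  have h3 := Real.sqrt_nonneg (16 * τ * L ^ 2 / (3 * β))
  refine ⟨by positivity, ?_, ?_, ?_, ?_⟩
  · rw [one_div]
    exact inv_anti₀ (by positivity) (by linarith)
  all_goals
    refine inv_le_sqrt_of_sqrt_inv_le (by positivity) ?_
    rw [inv_div]
    linarith

/-- With τ ≤ 23/(δβ), where 23 ≥ 64/3 + 1, the summands of 1/η are at most 4, 6, 138 and 12 times
L/(δ^(3/2) * β); these add up to 160. The third one, of order L * τ/√δ, fixes the power of δ. -/
lemma inv_tunedEta_le {δ σ L Δ : ℝ} (hδ : 0 < δ) (hδ1 : δ ≤ 1) (hL : 0 < L) (T : ℕ) :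
    (tunedEta δ σ L Δ T)⁻¹ ≤ 160 * L / (√δ ^ 3 * tunedBeta δ σ L Δ T) := by
  obtain ⟨hβ, hβ1⟩ := tunedBeta_pos_le (δ := δ) (σ := σ) (L := L) (Δ := Δ) T
  have hτ : 0 < (tunedTau δ σ L Δ T : ℝ) := lt_of_lt_of_le (by positivity) (le_tunedTau T)
  have hτ1 := tunedTau_le_add_one (σ := σ) (L := L) (Δ := Δ) hδ T
  unfold tunedEta
  rw [inv_inv]
  set β := tunedBeta δ σ L Δ T
  set τ := (tunedTau δ σ L Δ T : ℝ)
  have hs : 0 < √δ := Real.sqrt_pos.2 hδ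
  have hs1 : √δ ≤ 1 := Real.sqrt_le_one.2 hδ1
  have hss : δ = √δ ^ 2 := (Real.sq_sqrt hδ.le).symm
  set s := √δ
  have hs3 : s ^ 3 ≤ s := by simpa using pow_le_pow_of_le_one hs.le hs1 (show 1 ≤ 3 by norm_num)
  have hs31 : s ^ 3 * β ≤ 1 := by
    calc s ^ 3 * β ≤ s * β := by gcongr
      _ ≤ 1 * 1 := by gcongr
      _ = 1 := one_mul 1
  have hτ2 : τ ≤ 23 / (s ^ 2 * β) := by
    refine hτ1.trans ?_
    have : s ^ 2 * β ≤ 1 := by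
      calc s ^ 2 * β ≤ 1 * 1 := by gcongr; exact pow_le_one₀ hs.le hs1
        _ = 1 := one_mul 1
    rw [hss, le_div_iff₀ (by positivity), add_mul]
    have : 64 / (3 * s ^ 2 * β) * (s ^ 2 * β) = 64 / 3 := by field_simp
    linarith
  have hX : 1 ≤ 1 / (s ^ 3 * β) := (le_div_iff₀ (by positivity)).2 (by linarith)
  have hY : 1 / (s * β) ≤ 1 / (s ^ 3 * β) := by gcongr
  have h1 : √(80 * L ^ 2 / (3 * δ * β ^ 2)) ≤ 6 * L * (1 / (s * β)) := by
    refine Real.sqrt_le_iff.2 ⟨by positivity, ?_⟩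
    have e : (6 * L * (1 / (s * β))) ^ 2 = 108 * L ^ 2 / (3 * δ * β ^ 2) := by
      rw [hss]; field_simp; norm_num
    rw [e]
    gcongr; norm_num
  have h2 : √(80 * τ ^ 2 * L ^ 2 / (3 * δ)) ≤ 138 * L * (1 / (s ^ 3 * β)) := by
    refine Real.sqrt_le_iff.2 ⟨by positivity, ?_⟩
    have e : (138 * L * (1 / (s ^ 3 * β))) ^ 2
        = 108 * (23 / (s ^ 2 * β)) ^ 2 * L ^ 2 / (3 * δ) := by
      rw [hss]; field_simp; norm_num
    rw [e]
    gcongr; norm_num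
  have h3 : √(16 * τ * L ^ 2 / (3 * β)) ≤ 12 * L * (1 / (s * β)) := by
    refine Real.sqrt_le_iff.2 ⟨by positivity, ?_⟩
    calc 16 * τ * L ^ 2 / (3 * β) ≤ 16 * (23 / (s ^ 2 * β)) * L ^ 2 / (3 * β) := by gcongr
      _ = 368 / 3 * (L * (1 / (s * β))) ^ 2 := by field_simp; norm_num
      _ ≤ 144 * (L * (1 / (s * β))) ^ 2 := by gcongr; norm_num
      _ = _ := by ring
  have h4 := mul_le_mul_of_nonneg_left hX hL.le
  have h5 := mul_le_mul_of_nonneg_left hY hL.le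
  have e : 160 * L / (s ^ 3 * β) = 160 * (L * (1 / (s ^ 3 * β))) := by ring
  rw [e]
  linarith

/-- The right-hand side of the general bound at the tuned hyperparameters. -/
lemma tuned_bound_le {δ σ L Δ : ℝ} (hδ : 0 < δ) (hδ1 : δ ≤ 1) (hσ : 0 < σ) (hL : 0 < L)
    (hΔ : 0 < Δ) (T : ℕ) (hT : 0 < T) :
    16 * Δ / (δ * tunedEta δ σ L Δ T * T) + 64 * tunedBeta δ σ L Δ T * σ ^ 2 / (3 * δ)
      ≤ 2600 * (L * Δ / (δ ^ (5 / 2 : ℝ) * T) + √(L * Δ * σ ^ 2 / (δ ^ (7 / 2 : ℝ) * T))) := by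
  have hη := inv_tunedEta_le (σ := σ) (Δ := Δ) hδ hδ1 hL T
  have hη0 := (tunedEta_le (σ := σ) (Δ := Δ) hδ hL T).1
  have e3 : δ ^ (3 / 2 : ℝ) = √δ ^ 3 := by simpa using rpow_half_eq hδ.le 3
  have e5 : δ ^ (5 / 2 : ℝ) = √δ ^ 5 := by simpa using rpow_half_eq hδ.le 5
  have e7 : δ ^ (7 / 2 : ℝ) = √δ ^ 7 := by simpa using rpow_half_eq hδ.le 7
  have hβ : tunedBeta δ σ L Δ T = (1 + √(√δ ^ 3 * σ ^ 2 * T / (L * Δ)))⁻¹ := by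
    rw [tunedBeta, e3]
  rw [e5, e7]
  rw [hβ] at hη ⊢
  have hs : 0 < √δ := Real.sqrt_pos.2 hδ
  have hss : √δ ^ 2 = δ := Real.sq_sqrt hδ.le
  set s := √δ
  have hT0 : (0 : ℝ) < T := Nat.cast_pos.2 hT
  set η := tunedEta δ σ L Δ T
  have hr : 0 < √(s ^ 3 * σ ^ 2 * T / (L * Δ)) := Real.sqrt_pos.2 (by positivity)
  have hr2 : √(s ^ 3 * σ ^ 2 * T / (L * Δ)) ^ 2 = s ^ 3 * σ ^ 2 * T / (L * Δ) :=
    Real.sq_sqrt (by positivity)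
  set r := √(s ^ 3 * σ ^ 2 * T / (L * Δ))
  -- Since 1/β = 1 + r, the optimization term grows like r and the noise term is at most of order
  -- 1/r. The chosen r makes the two products equal, and both equal the square root in the rate.
  have hR1 : √(L * Δ * σ ^ 2 / (s ^ 7 * T)) = L * Δ / (s ^ 5 * T) * r := by
    rw [Real.sqrt_eq_iff_mul_self_eq_of_pos (by positivity), ← sq, mul_pow, hr2]
    field_simp
  have hR2 : √(L * Δ * σ ^ 2 / (s ^ 7 * T)) = σ ^ 2 / s ^ 2 * r⁻¹ := by
    rw [Real.sqrt_eq_iff_mul_self_eq_of_pos (by positivity), ← sq, mul_pow, inv_pow, hr2]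
    field_simp
  have h1 : 16 * Δ / (δ * η * T) ≤ 2560 * (L * Δ / (s ^ 5 * T) * (1 + r)) := by
    calc 16 * Δ / (δ * η * T) = 16 * Δ / (s ^ 2 * T) * η⁻¹ := by rw [hss]; field_simp
      _ ≤ 16 * Δ / (s ^ 2 * T) * (160 * L / (s ^ 3 * (1 + r)⁻¹)) := by gcongr
      _ = _ := by field_simp; norm_num
  have h2 : 64 * (1 + r)⁻¹ * σ ^ 2 / (3 * δ) ≤ 40 * (σ ^ 2 / s ^ 2 * r⁻¹) := by
    calc 64 * (1 + r)⁻¹ * σ ^ 2 / (3 * δ) = 64 / 3 * (σ ^ 2 / s ^ 2 * (1 + r)⁻¹) := by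
          rw [hss]; field_simp
      _ ≤ 40 * (σ ^ 2 / s ^ 2 * r⁻¹) := by gcongr <;> linarith
  rw [← hR2] at h2
  rw [mul_add, mul_one, ← hR1] at h1
  have : 0 ≤ L * Δ / (s ^ 5 * T) := by positivity
  linarith

lemma two_le_minIterations {δ σ L Δ : ℝ} (hδ : 0 < δ) (hL : 0 < L) (hΔ : 0 < Δ) :
    2 ≤ minIterations δ σ L Δ := by
  have h1 : 0 ≤ 128 / (3 * δ) := by positivity
  have h2 : 0 ≤ (128 * σ) ^ 2 / (9 * √δ * L * Δ) := by positivity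
  unfold minIterations
  linarith

/-- The number of iterations that suffices for accuracy `ε`. -/
lemma exists_iterations {δ σ L Δ ε : ℝ} (hδ : 0 < δ) (hδ1 : δ ≤ 1) (hL : 0 < L)
    (hΔ : 0 < Δ) (hε : 0 < ε) :
    ∃ T₀ : ℕ, (T₀ : ℝ) ≤ 3 * 10 ^ 7 * (L * Δ * σ ^ 2 / (δ ^ (7 / 2 : ℝ) * ε ^ 2)
        + L * Δ / (δ ^ (5 / 2 : ℝ) * ε) + σ ^ 2 / (δ ^ (1 / 2 : ℝ) * L * Δ) + 1 / δ) ∧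
      ∀ T : ℕ, T₀ ≤ T → minIterations δ σ L Δ ≤ (T : ℝ) ∧
        2600 * (L * Δ / (δ ^ (5 / 2 : ℝ) * T) + √(L * Δ * σ ^ 2 / (δ ^ (7 / 2 : ℝ) * T)))
          ≤ ε := by
  have e1 : δ ^ (1 / 2 : ℝ) = √δ := by rw [Real.sqrt_eq_rpow]
  have hmin := two_le_minIterations (σ := σ) hδ hL hΔ
  have h5 : 0 < δ ^ (5 / 2 : ℝ) := by positivity
  have h7 : 0 < δ ^ (7 / 2 : ℝ) := by positivity
  set d5 := δ ^ (5 / 2 : ℝ)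
  set d7 := δ ^ (7 / 2 : ℝ)
  have hs : 0 < √δ := Real.sqrt_pos.2 hδ
  set A := L * Δ * σ ^ 2 / (d7 * ε ^ 2) with hA
  set B := L * Δ / (d5 * ε) with hB
  have hA0 : 0 ≤ A := by positivity
  have hB0 : 0 ≤ B := by positivity
  -- The terms in B and A make each of the two summands of the rate at most ε/5200, so that 2600
  -- times their sum is at most ε.
  refine ⟨⌈minIterations δ σ L Δ + 2 * 2600 * B + 4 * 2600 ^ 2 * A⌉₊, ?_, ?_⟩
  · refine (Nat.ceil_lt_add_one (by positivity)).le.trans ?_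
    rw [e1]
    have hδi : 1 ≤ 1 / δ := (one_le_div hδ).2 hδ1
    have e2 : 128 / (3 * δ) = 128 / 3 * (1 / δ) := by field_simp
    have e3 : (128 * σ) ^ 2 / (9 * √δ * L * Δ) = 128 ^ 2 / 9 * (σ ^ 2 / (√δ * L * Δ)) := by
      field_simp
    have : 0 ≤ σ ^ 2 / (√δ * L * Δ) := by positivity
    unfold minIterations
    rw [e2, e3]
    linarith
  · intro T hT
    have hT' := Nat.ceil_le.1 hT
    have hmT : minIterations δ σ L Δ ≤ T := by linarith
    have hT0 : (0 : ℝ) < T := by linarith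
    refine ⟨hmT, ?_⟩
    have hb : L * Δ / (d5 * T) ≤ ε / 5200 := by
      have : 5200 * B ≤ T := by linarith
      calc L * Δ / (d5 * T) = ε / 5200 * (5200 * B) / T := by rw [hB]; field_simp
        _ ≤ ε / 5200 * T / T := by gcongr
        _ = ε / 5200 := by field_simp
    have ha : √(L * Δ * σ ^ 2 / (d7 * T)) ≤ ε / 5200 := by
      refine Real.sqrt_le_iff.2 ⟨by positivity, ?_⟩
      have : 5200 ^ 2 * A ≤ T := by linarith
      calc L * Δ * σ ^ 2 / (d7 * T) = (ε / 5200) ^ 2 * (5200 ^ 2 * A) / T := by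
            rw [hA]; field_simp
        _ ≤ (ε / 5200) ^ 2 * T / T := by gcongr
        _ = (ε / 5200) ^ 2 := by field_simp
    linarith

end GoSare

/-! ### Deterministic inequalities: masks, momentum error, descent, drift -/

namespace GoSare

open MeasureTheory ProbabilityTheory

section Masks

variable {ι : Type*}

/-- Entrywise multiplication of a vector by a mask. -/
def maskMul (s : ι → ℝ) (v : EuclideanSpace ℝ ι) : EuclideanSpace ℝ ι :=
  WithLp.toLp 2 fun i => s i * v i

/-- All entries of `s` are `0` or `1`. -/
def IsMask (s : ι → ℝ) : Prop := ∀ i, s i = 0 ∨ s i = 1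

@[simp] lemma maskMul_apply (s : ι → ℝ) (v : EuclideanSpace ℝ ι) (i : ι) :
    maskMul s v i = s i * v i := rfl

lemma maskMul_add (s : ι → ℝ) (v w : EuclideanSpace ℝ ι) :
    maskMul s (v + w) = maskMul s v + maskMul s w := by
  ext i; simp [mul_add]

lemma maskMul_sub (s : ι → ℝ) (v w : EuclideanSpace ℝ ι) :
    maskMul s (v - w) = maskMul s v - maskMul s w := by
  ext i; simp [mul_sub]

lemma maskMul_smul (s : ι → ℝ) (c : ℝ) (v : EuclideanSpace ℝ ι) :
    maskMul s (c • v) = c • maskMul s v := by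
  ext i; simp [mul_left_comm]

lemma measurable_maskMul :
    Measurable fun p : (ι → ℝ) × EuclideanSpace ℝ ι => maskMul p.1 p.2 := by
  unfold maskMul
  fun_prop

lemma maskMul_idem {s : ι → ℝ} (hs : IsMask s) (v : EuclideanSpace ℝ ι) :
    maskMul s (maskMul s v) = maskMul s v := by
  ext i
  rcases hs i with h | h <;> simp [h]

variable [Fintype ι]

lemma norm_sq_maskMul {s : ι → ℝ} (hs : IsMask s) (v : EuclideanSpace ℝ ι) :
    ‖maskMul s v‖ ^ 2 = ∑ i, s i * v i ^ 2 := by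
  rw [EuclideanSpace.real_norm_sq_eq]
  refine Finset.sum_congr rfl fun i _ => ?_
  rcases hs i with h | h <;> simp [h]

lemma norm_maskMul_le {s : ι → ℝ} (hs : IsMask s) (v : EuclideanSpace ℝ ι) :
    ‖maskMul s v‖ ≤ ‖v‖ := by
  refine le_of_sq_le_sq ?_ (norm_nonneg v)
  rw [norm_sq_maskMul hs, EuclideanSpace.real_norm_sq_eq]
  refine Finset.sum_le_sum fun i _ => ?_
  rcases hs i with h | h <;> simp [h, sq_nonneg]

lemma norm_sq_maskMul_le {s : ι → ℝ} (hs : IsMask s) (v : EuclideanSpace ℝ ι) :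
    ‖maskMul s v‖ ^ 2 ≤ ‖v‖ ^ 2 :=
  pow_le_pow_left₀ (norm_nonneg _) (norm_maskMul_le hs v) 2

lemma inner_maskMul (s : ι → ℝ) (v w : EuclideanSpace ℝ ι) :
    inner ℝ (maskMul s v) w = inner ℝ v (maskMul s w) := by
  simp only [PiLp.inner_apply, maskMul_apply]
  refine Finset.sum_congr rfl fun i _ => ?_
  simp; ring

/-- Pythagoras for the coordinates inside and outside a mask. -/
lemma norm_sq_sub_of_maskMul_eq {s : ι → ℝ} (hs : IsMask s) {v w : EuclideanSpace ℝ ι}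
    (hw : maskMul s w = w) :
    ‖v - w‖ ^ 2 ≤ ‖maskMul s v - w‖ ^ 2 + ‖v‖ ^ 2 := by
  rw [← hw]
  simp only [EuclideanSpace.real_norm_sq_eq, ← Finset.sum_add_distrib]
  refine Finset.sum_le_sum fun i _ => ?_
  rcases hs i with h | h <;> simp [h, sq_nonneg]

end Masks

section Pathwise

variable {ι : Type*} [Fintype ι] {β η L : ℝ}

/-- Young's inequality with weights 1 + β and 1 + 1/β. One of the two factors 1 - β absorbs the
weight 1 + β, so the old error still contracts by 1 - β. -/
lemma young_contraction {E : Type*} [NormedAddCommGroup E] (hβ : 0 < β) (hβ1 : β ≤ 1)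
    (a b : E) : (1 - β) ^ 2 * ‖a + b‖ ^ 2 ≤ (1 - β) * ‖a‖ ^ 2 + 1 / β * ‖b‖ ^ 2 := by
  have h1 : ‖a + b‖ ^ 2 ≤ (‖a‖ + ‖b‖) ^ 2 := pow_le_pow_left₀ (norm_nonneg _) (norm_add_le a b) 2
  set x := ‖a‖
  set y := ‖b‖
  have h2 : 0 ≤ 1 - β := by linarith
  have h3 : (x + y) ^ 2 ≤ (1 + β) * x ^ 2 + (1 + 1 / β) * y ^ 2 := by
    have h4 : 0 ≤ (β * x - y) ^ 2 / β := by positivity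
    have h5 : (β * x - y) ^ 2 / β = β * x ^ 2 - 2 * x * y + 1 / β * y ^ 2 := by
      field_simp; ring
    linarith
  have h6 : (1 - β) ^ 2 * (1 + β) ≤ 1 - β := by nlinarith [mul_nonneg h2 (sq_nonneg β)]
  have h7 : (1 - β) ^ 2 * (1 + 1 / β) ≤ 1 / β := by
    have e : (1 - β) ^ 2 * (1 + 1 / β) = (1 - β) ^ 2 * (1 + β) * (1 / β) := by
      field_simp
      ring
    rw [e]
    exact mul_le_of_le_one_left (by positivity) (by linarith)
  calc (1 - β) ^ 2 * ‖a + b‖ ^ 2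
      ≤ (1 - β) ^ 2 * ((1 + β) * x ^ 2 + (1 + 1 / β) * y ^ 2) := by
        gcongr; linarith
    _ = (1 - β) ^ 2 * (1 + β) * x ^ 2 + (1 - β) ^ 2 * (1 + 1 / β) * y ^ 2 := by ring
    _ ≤ _ := by gcongr

variable {s s' : ι → ℝ} {g g' M : EuclideanSpace ℝ ι}

/-- One step of the momentum error while the mask is kept. -/
lemma momentum_error_same (hβ : 0 < β) (hβ1 : β ≤ 1) (hs : IsMask s)
    (hM : maskMul s M = M) (hg : ‖g' - g‖ ≤ L * (η * ‖M‖)) :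
    (1 - β) ^ 2 * ‖maskMul s (g' - M)‖ ^ 2
      ≤ (1 - β) * ‖maskMul s g - M‖ ^ 2 + L ^ 2 * η ^ 2 / β * ‖M‖ ^ 2 := by
  have e : maskMul s (g' - M) = (maskMul s g - M) + maskMul s (g' - g) := by
    rw [maskMul_sub, maskMul_sub, hM]; abel
  rw [e]
  refine (young_contraction hβ hβ1 _ _).trans ?_
  have : ‖maskMul s (g' - g)‖ ^ 2 ≤ (L * (η * ‖M‖)) ^ 2 :=
    pow_le_pow_left₀ (norm_nonneg _) ((norm_maskMul_le hs _).trans hg) 2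
  calc _ ≤ (1 - β) * ‖maskMul s g - M‖ ^ 2 + 1 / β * (L * (η * ‖M‖)) ^ 2 := by gcongr
    _ = _ := by ring

/-- One step of the momentum error when the mask `s` is replaced by the mask `s'`. -/
lemma momentum_error_change (hβ : 0 < β) (hβ1 : β ≤ 1) (hs : IsMask s) (hs' : IsMask s')
    (hM : maskMul s M = M) (hg : ‖g' - g‖ ≤ L * (η * ‖M‖)) :
    (1 - β) ^ 2 * ‖maskMul s' (g' - M)‖ ^ 2
      ≤ (1 - β) * ‖maskMul s g - M‖ ^ 2 + L ^ 2 * η ^ 2 / β * ‖M‖ ^ 2 + ‖g'‖ ^ 2 := by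
  have h1 := momentum_error_same hβ hβ1 hs hM hg
  -- The new mask is simply dropped. Inside the old mask the error is as before; outside it M
  -- vanishes and only g' remains.
  have h2 : ‖maskMul s' (g' - M)‖ ^ 2 ≤ ‖maskMul s (g' - M)‖ ^ 2 + ‖g'‖ ^ 2 := by
    refine (norm_sq_maskMul_le hs' _).trans ?_
    rw [maskMul_sub, hM]
    exact norm_sq_sub_of_maskMul_eq hs hM
  have h3 : (1 - β) ^ 2 ≤ 1 := pow_le_one₀ (by linarith) (by linarith)
  have h4 : (1 - β) ^ 2 * ‖g'‖ ^ 2 ≤ ‖g'‖ ^ 2 := mul_le_of_le_one_left (by positivity) h3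
  have h5 := mul_le_mul_of_nonneg_left h2 (sq_nonneg (1 - β))
  linarith

/-- The descent inequality for a step along the masked momentum. -/
lemma descent_step {f₀ f₁ : ℝ} (hM : maskMul s M = M)
    (hf : f₁ ≤ f₀ + inner ℝ g (-(η • M)) + L / 2 * ‖-(η • M)‖ ^ 2) :
    f₁ ≤ f₀ - η / 2 * ‖maskMul s g‖ ^ 2 - η / 2 * (1 - L * η) * ‖M‖ ^ 2
      + η / 2 * ‖maskMul s g - M‖ ^ 2 := by
  -- As M is supported in the mask, ⟨g, M⟩ = ⟨S⊙g, M⟩; polarization turns this into the three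
  -- squared norms of the claim.
  rw [inner_neg_right, inner_smul_right, ← hM, ← inner_maskMul, hM, norm_neg, norm_smul, mul_pow,
    Real.norm_eq_abs, sq_abs] at hf
  rw [norm_sub_sq_real]
  linarith

/-- A rearranged ‖a‖² ≤ 2‖b‖² + 2‖b - a‖². With a at the period start it bounds later masked
gradients below; with b at the period start it bounds later gradients above. -/
lemma half_norm_sq_le {E : Type*} [SeminormedAddCommGroup E] (a b : E) :
    1 / 2 * ‖a‖ ^ 2 - ‖b - a‖ ^ 2 ≤ ‖b‖ ^ 2 := by
  have h : ‖a‖ ≤ ‖b‖ + ‖b - a‖ := by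
    have := norm_sub_le b (b - a)
    rwa [sub_sub_cancel] at this
  nlinarith [sq_nonneg (‖b‖ - ‖b - a‖), norm_nonneg a, norm_nonneg b, norm_nonneg (b - a)]

/-- The drift of the iterates inside a period. -/
lemma drift_le {E : Type*} [NormedAddCommGroup E] [NormedSpace ℝ E] {x Mm : ℕ → E} {τ r : ℕ}
    (hx : ∀ t, x (t + 1) = x t - η • Mm t) (hr : r < τ) :
    ‖x r - x 0‖ ^ 2 ≤ η ^ 2 * τ * ∑ t ∈ Finset.range τ, ‖Mm t‖ ^ 2 := by
  have h1 : ∀ r, x r - x 0 = -(η • ∑ t ∈ Finset.range r, Mm t) := by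
    intro r
    induction r with
    | zero => simp
    | succ r ih =>
      rw [Finset.sum_range_succ, hx, smul_add, neg_add, ← ih]; abel
  rw [h1, norm_neg, norm_smul, mul_pow, Real.norm_eq_abs, sq_abs, mul_assoc]
  refine mul_le_mul_of_nonneg_left ?_ (sq_nonneg η)
  calc ‖∑ t ∈ Finset.range r, Mm t‖ ^ 2 ≤ (∑ t ∈ Finset.range r, ‖Mm t‖) ^ 2 :=
        pow_le_pow_left₀ (norm_nonneg _) (norm_sum_le _ _) 2
    _ ≤ (∑ t ∈ Finset.range τ, ‖Mm t‖) ^ 2 := by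
        refine pow_le_pow_left₀ (by positivity) ?_ 2
        exact Finset.sum_le_sum_of_subset_of_nonneg (Finset.range_mono hr.le)
          fun _ _ _ => norm_nonneg _
    _ ≤ τ * ∑ t ∈ Finset.range τ, ‖Mm t‖ ^ 2 := by
        simpa using sq_sum_le_card_mul_sum_sq (s := Finset.range τ) (f := fun t => ‖Mm t‖)

end Pathwise

section Smooth

variable {E : Type*} [NormedAddCommGroup E] [InnerProductSpace ℝ E] [CompleteSpace E]

/-- The quadratic upper bound for a function with Lipschitz gradient. -/
lemma le_quadratic_of_lipschitz_gradient {f : E → ℝ} {L : ℝ} (hf : Differentiable ℝ f)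
    (hlip : ∀ x y, ‖gradient f x - gradient f y‖ ≤ L * ‖x - y‖) (x y : E) :
    f y ≤ f x + inner ℝ (gradient f x) (y - x) + L / 2 * ‖y - x‖ ^ 2 := by
  set v := y - x with hv
  -- Along the segment, φ is f minus its linear part and the claimed quadratic. Cauchy–Schwarz and
  -- the Lipschitz bound make φ' ≤ 0 on (0, 1), and the claim is φ 1 ≤ φ 0.
  set φ : ℝ → ℝ := fun s => f (x + s • v) - s * inner ℝ (gradient f x) v - L / 2 * s ^ 2 * ‖v‖ ^ 2
    with hφ
  have hd : ∀ s, HasDerivAt φ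
      (inner ℝ (gradient f (x + s • v)) v - inner ℝ (gradient f x) v - L * s * ‖v‖ ^ 2) s := by
    intro s
    have h1 : HasDerivAt (fun s : ℝ => x + s • v) v s := by
      simpa using ((hasDerivAt_id s).smul_const v).const_add x
    have h2 : HasDerivAt (fun s : ℝ => f (x + s • v)) (inner ℝ (gradient f (x + s • v)) v) s := by
      have := (hf (x + s • v)).hasGradientAt.hasFDerivAt.comp_hasDerivAt s h1
      simpa [Function.comp_def] using this
    have h3 : HasDerivAt (fun s : ℝ => s * inner ℝ (gradient f x) v) (inner ℝ (gradient f x) v) s := by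
      simpa using (hasDerivAt_id s).mul_const (inner ℝ (gradient f x) v)
    have h4 : HasDerivAt (fun s : ℝ => L / 2 * s ^ 2 * ‖v‖ ^ 2) (L * s * ‖v‖ ^ 2) s := by
      have := ((hasDerivAt_pow 2 s).const_mul (L / 2)).mul_const (‖v‖ ^ 2)
      exact this.congr_deriv (by push_cast; ring)
    exact (h2.sub h3).sub h4
  have hanti : AntitoneOn φ (Set.Icc 0 1) := by
    refine antitoneOn_of_deriv_nonpos (convex_Icc 0 1)
      (fun s _ => (hd s).continuousAt.continuousWithinAt)
      (fun s _ => (hd s).differentiableAt.differentiableWithinAt) fun s hs => ?_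
    rw [interior_Icc] at hs
    rw [(hd s).deriv, ← inner_sub_left]
    have h1 := real_inner_le_norm (gradient f (x + s • v) - gradient f x) v
    have h2 := hlip (x + s • v) x
    rw [add_sub_cancel_left, norm_smul, Real.norm_of_nonneg hs.1.le] at h2
    nlinarith [norm_nonneg v]
  have h := hanti (Set.left_mem_Icc.2 zero_le_one) (Set.right_mem_Icc.2 zero_le_one) zero_le_one
  simp only [hφ, one_smul, zero_smul, add_zero, hv, add_sub_cancel] at h
  simp only [hv]
  linarith

end Smooth

end GoSare

/-! ### Noise and second moments of masked momentum SGD -/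

namespace GoSare

open MeasureTheory ProbabilityTheory

section Noise

variable {Ξ E : Type*} [MeasurableSpace Ξ] {D : Measure Ξ} [IsProbabilityMeasure D]
  [NormedAddCommGroup E] [InnerProductSpace ℝ E] [CompleteSpace E]

/-- Adding centred noise of variance at most `v` increases the second moment by at most `v`. -/
lemma lintegral_norm_sq_add_noise_le {Z : Ξ → E} {v : ℝ} (hZ : Integrable Z D)
    (h0 : ∫ s, Z s ∂D = 0) (hZ2 : Integrable (fun s => ‖Z s‖ ^ 2) D)
    (hv : ∫ s, ‖Z s‖ ^ 2 ∂D ≤ v) (a : E) :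
    ∫⁻ s, ENNReal.ofReal (‖a + Z s‖ ^ 2) ∂D ≤ ENNReal.ofReal (‖a‖ ^ 2 + v) := by
  have hi : Integrable (fun s => 2 * inner ℝ a (Z s)) D := (hZ.const_inner a).const_mul 2
  have he : ∀ s, ‖a + Z s‖ ^ 2 = ‖a‖ ^ 2 + 2 * inner ℝ a (Z s) + ‖Z s‖ ^ 2 :=
    fun s => norm_add_sq_real a (Z s)
  have hi' : Integrable (fun s => ‖a‖ ^ 2 + 2 * inner ℝ a (Z s)) D := (integrable_const _).add hi
  have hint : Integrable (fun s => ‖a + Z s‖ ^ 2) D := by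
    simp only [he]
    exact hi'.add hZ2
  rw [← ofReal_integral_eq_lintegral_ofReal hint (ae_of_all _ fun s => sq_nonneg _)]
  refine ENNReal.ofReal_le_ofReal ?_
  simp only [he]
  have h1 : ∫ s, 2 * inner ℝ a (Z s) ∂D = 0 := by
    rw [integral_const_mul, integral_inner hZ, h0, inner_zero_right, mul_zero]
  rw [integral_add hi' hZ2, integral_add (integrable_const _) hi, h1]
  simpa using hv

end Noise

/-- Estimates are made with `lintegral`, where Tonelli needs no prior integrability; this recovers
integrability together with the real bound. -/
lemma integrable_norm_sq_of_lintegral {Ω : Type*} [MeasurableSpace Ω] {μ : Measure Ω}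
    {h : Ω → ℝ} (hm : Measurable h) (h0 : ∀ ω, 0 ≤ h ω) {c : ℝ} (hc : 0 ≤ c)
    (hle : ∫⁻ ω, ENNReal.ofReal (h ω) ∂μ ≤ ENNReal.ofReal c) :
    Integrable h μ ∧ ∫ ω, h ω ∂μ ≤ c := by
  have hi : Integrable h μ := by
    refine ⟨hm.aestronglyMeasurable, ?_⟩
    rw [hasFiniteIntegral_iff_ofReal (ae_of_all _ h0)]
    exact hle.trans_lt ENNReal.ofReal_lt_top
  refine ⟨hi, ?_⟩
  rw [← ofReal_integral_eq_lintegral_ofReal hi (ae_of_all _ h0)] at hle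
  exact (ENNReal.ofReal_le_ofReal_iff hc).1 hle

variable {ι Ξ Ω : Type*} [Fintype ι] [MeasurableSpace Ξ] [MeasurableSpace Ω]

/-- Momentum SGD on `f`, with gradient `g` and stochastic gradients `γ`, in which period `j`
of length `τ` uses the random mask `u j`. `X t` is the iterate and `M t` the momentum at the
beginning of iteration `t`. -/
structure IsMaskedMSGD (D : Measure Ξ) (μ : Measure Ω) (f : EuclideanSpace ℝ ι → ℝ)
    (g : EuclideanSpace ℝ ι → EuclideanSpace ℝ ι) (γ : EuclideanSpace ℝ ι → Ξ → EuclideanSpace ℝ ι)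
    (L v δ c β η : ℝ) (τ : ℕ) (x₀ : EuclideanSpace ℝ ι) (ξ : ℕ → Ω → Ξ) (u : ℕ → Ω → ι → ℝ)
    (X M : ℕ → Ω → EuclideanSpace ℝ ι) : Prop where
  lipschitz : ∀ x y, ‖g x - g y‖ ≤ L * ‖x - y‖
  quadratic : ∀ x y, f y ≤ f x + inner ℝ (g x) (y - x) + L / 2 * ‖y - x‖ ^ 2
  bounded_below : ∀ x, c ≤ f x
  measurable_f : Measurable f
  measurable_γ : Measurable fun p : EuclideanSpace ℝ ι × Ξ => γ p.1 p.2
  integrable_γ : ∀ x, Integrable (γ x) D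
  integral_γ : ∀ x, ∫ s, γ x s ∂D = g x
  integrable_sq : ∀ x, Integrable (fun s => ‖γ x s - g x‖ ^ 2) D
  variance_le : ∀ x, ∫ s, ‖γ x s - g x‖ ^ 2 ∂D ≤ v
  measurable_ξ : ∀ t, Measurable (ξ t)
  measurable_u : ∀ j, Measurable (u j)
  measurable_X : ∀ t, Measurable (X t)
  measurable_M : ∀ t, Measurable (M t)
  law_ξ : ∀ t, μ.map (ξ t) = D
  isMask : ∀ j, ∀ᵐ ω ∂μ, IsMask (u j ω)
  mask_mean : ∀ j i, δ ≤ ∫ ω, u j ω i ∂μ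
  X_zero : ∀ ω, X 0 ω = x₀
  M_zero : ∀ ω, M 0 ω = 0
  M_succ : ∀ t ω, M (t + 1) ω
    = maskMul (u (t / τ) ω) ((1 - β) • M t ω + β • γ (X t ω) (ξ t ω))
  X_succ : ∀ t ω, X (t + 1) ω = X t ω - η • maskMul (u (t / τ) ω) (M (t + 1) ω)
  indep_ξ : ∀ t, IndepFun (fun ω => (X t ω, M t ω, u (t / τ) ω)) (ξ t) μ
  indep_u : ∀ j i, IndepFun (X (j * τ)) (fun ω => u j ω i) μ

namespace IsMaskedMSGD

variable {D : Measure Ξ} {μ : Measure Ω}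
  {f : EuclideanSpace ℝ ι → ℝ} {g : EuclideanSpace ℝ ι → EuclideanSpace ℝ ι}
  {γ : EuclideanSpace ℝ ι → Ξ → EuclideanSpace ℝ ι} {L v δ c β η : ℝ} {τ : ℕ}
  {x₀ : EuclideanSpace ℝ ι} {ξ : ℕ → Ω → Ξ} {u : ℕ → Ω → ι → ℝ}
  {X M : ℕ → Ω → EuclideanSpace ℝ ι}

section
variable (h : IsMaskedMSGD D μ f g γ L v δ c β η τ x₀ ξ u X M)
include h

lemma measurable_g : Measurable g :=
  (LipschitzWith.of_dist_le' (K := L) fun x y => by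
    simpa [dist_eq_norm] using h.lipschitz x y).continuous.measurable

lemma mask_M_succ (t : ℕ) :
    ∀ᵐ ω ∂μ, maskMul (u (t / τ) ω) (M (t + 1) ω) = M (t + 1) ω := by
  filter_upwards [h.isMask (t / τ)] with ω hω
  rw [h.M_succ, maskMul_idem hω]

lemma X_succ_ae (t : ℕ) : ∀ᵐ ω ∂μ, X (t + 1) ω = X t ω - η • M (t + 1) ω := by
  filter_upwards [h.mask_M_succ t] with ω hω
  rw [h.X_succ, hω]

lemma variance_nonneg : 0 ≤ v :=
  (integral_nonneg fun _ => sq_nonneg _).trans (h.variance_le x₀)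

lemma memLp_g [IsProbabilityMeasure μ] {t : ℕ} (hX : MemLp (X t) 2 μ) : MemLp (fun ω => g (X t ω)) 2 μ := by
  have h1 : MemLp (fun ω => g (X t ω) - g x₀) 2 μ := by
    refine MemLp.of_le_mul (c := L) (hX.sub (memLp_const x₀))
      ((h.measurable_g.comp (h.measurable_X t)).sub_const _).aestronglyMeasurable
      (ae_of_all _ fun ω => ?_)
    exact h.lipschitz _ _
  have h2 := h1.add (memLp_const (g x₀))
  simpa [Pi.add_def] using h2

lemma memLp_mask {A : Ω → EuclideanSpace ℝ ι} (hA : MemLp A 2 μ) (hm : Measurable A) (j : ℕ) :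
    MemLp (fun ω => maskMul (u j ω) (A ω)) 2 μ := by
  refine hA.mono (measurable_maskMul.comp ((h.measurable_u j).prodMk hm)).aestronglyMeasurable ?_
  filter_upwards [h.isMask j] with ω hω using norm_maskMul_le hω _

/-- Separates the part known before the sample ξ t is drawn from the noise, which is centred given
the state. -/
lemma error_eq (t : ℕ) (ω : Ω) :
    maskMul (u (t / τ) ω) (g (X t ω)) - M (t + 1) ω
      = (1 - β) • maskMul (u (t / τ) ω) (g (X t ω) - M t ω)
        + β • maskMul (u (t / τ) ω) (g (X t ω) - γ (X t ω) (ξ t ω)) := by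
  rw [h.M_succ, ← maskMul_sub, ← maskMul_smul, ← maskMul_smul, ← maskMul_add]
  congr 1
  module

variable [IsProbabilityMeasure D]

/-- The conditional estimate with the state frozen: x, s and a are deterministic and only the sample
is random. Masking is linear and norm-nonincreasing, so the noise stays centred with variance at
most β²v. -/
lemma noise_bound (x : EuclideanSpace ℝ ι) {s : ι → ℝ} (hs : IsMask s) (a : EuclideanSpace ℝ ι) :
    ∫⁻ z, ENNReal.ofReal (‖a + β • maskMul s (g x - γ x z)‖ ^ 2) ∂D
      ≤ ENNReal.ofReal (‖a‖ ^ 2 + β ^ 2 * v) := by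
  have hi : Integrable (fun z => g x - γ x z) D := (integrable_const _).sub (h.integrable_γ x)
  let P : EuclideanSpace ℝ ι →ₗ[ℝ] EuclideanSpace ℝ ι :=
    { toFun := fun w => β • maskMul s w
      map_add' := fun a b => by rw [maskMul_add, smul_add]
      map_smul' := fun c a => by rw [maskMul_smul, RingHom.id_apply, smul_comm] }
  have hle : ∀ z, ‖β • maskMul s (g x - γ x z)‖ ^ 2 ≤ β ^ 2 * ‖γ x z - g x‖ ^ 2 := by
    intro z
    rw [norm_smul, mul_pow, Real.norm_eq_abs, sq_abs, norm_sub_rev (γ x z)]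
    exact mul_le_mul_of_nonneg_left (norm_sq_maskMul_le hs _) (sq_nonneg β)
  have hP : Integrable (fun z => β • maskMul s (g x - γ x z)) D :=
    P.toContinuousLinearMap.integrable_comp hi
  have hP2 : Integrable (fun z => ‖β • maskMul s (g x - γ x z)‖ ^ 2) D := by
    refine ((h.integrable_sq x).const_mul (β ^ 2)).mono' (hP.aestronglyMeasurable.norm.pow 2)
      (ae_of_all _ fun z => ?_)
    rw [Real.norm_of_nonneg (sq_nonneg _)]
    exact hle z
  refine lintegral_norm_sq_add_noise_le hP ?_ hP2 ?_ a
  · have := P.toContinuousLinearMap.integral_comp_comm hi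
    rw [integral_sub (integrable_const _) (h.integrable_γ x), h.integral_γ] at this
    simp only [integral_const, probReal_univ, one_smul, sub_self, map_zero] at this
    exact this
  · refine (integral_mono hP2 ((h.integrable_sq x).const_mul _) hle).trans ?_
    rw [integral_const_mul]
    exact mul_le_mul_of_nonneg_left (h.variance_le x) (sq_nonneg β)

variable [IsProbabilityMeasure μ]

/-- The momentum error: the new stochastic gradient contributes at most `β ^ 2 * v`. -/
lemma error_bound {t : ℕ} (hX : MemLp (X t) 2 μ) (hM : MemLp (M t) 2 μ) :
    Integrable (fun ω => ‖maskMul (u (t / τ) ω) (g (X t ω)) - M (t + 1) ω‖ ^ 2) μ ∧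
    ∫ ω, ‖maskMul (u (t / τ) ω) (g (X t ω)) - M (t + 1) ω‖ ^ 2 ∂μ
      ≤ ∫ ω, (1 - β) ^ 2 * ‖maskMul (u (t / τ) ω) (g (X t ω) - M t ω)‖ ^ 2 ∂μ + β ^ 2 * v := by
  set j := t / τ
  have hgX := h.measurable_g.comp (h.measurable_X t)
  have hA2 : Integrable
      (fun ω => (1 - β) ^ 2 * ‖maskMul (u j ω) (g (X t ω) - M t ω)‖ ^ 2) μ :=
    (h.memLp_mask ((h.memLp_g hX).sub hM) (hgX.sub (h.measurable_M t)) j).integrable_norm_pow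
      (by norm_num) |>.const_mul _
  set Y : Ω → EuclideanSpace ℝ ι × EuclideanSpace ℝ ι × (ι → ℝ) :=
    fun ω => (X t ω, M t ω, u j ω) with hYdef
  have hY : Measurable Y :=
    (h.measurable_X t).prodMk ((h.measurable_M t).prodMk (h.measurable_u j))
  set A : EuclideanSpace ℝ ι × EuclideanSpace ℝ ι × (ι → ℝ) → EuclideanSpace ℝ ι :=
    fun y => (1 - β) • maskMul y.2.2 (g y.1 - y.2.1) with hAdef
  have hg := h.measurable_g
  have hA : Measurable A := by
    have : Measurable fun y : EuclideanSpace ℝ ι × EuclideanSpace ℝ ι × (ι → ℝ) =>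
        (y.2.2, g y.1 - y.2.1) := by fun_prop
    exact (measurable_maskMul.comp this).const_smul (1 - β)
  set H : (EuclideanSpace ℝ ι × EuclideanSpace ℝ ι × (ι → ℝ)) × Ξ → ℝ :=
    fun p => ‖A p.1 + β • maskMul p.1.2.2 (g p.1.1 - γ p.1.1 p.2)‖ ^ 2 with hHdef
  have hH : Measurable H := by
    have h1 : Measurable fun p : (EuclideanSpace ℝ ι × EuclideanSpace ℝ ι × (ι → ℝ)) × Ξ =>
        γ p.1.1 p.2 :=
      h.measurable_γ.comp (f := fun p : (EuclideanSpace ℝ ι × EuclideanSpace ℝ ι × (ι → ℝ)) × Ξ =>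
        (p.1.1, p.2)) (by fun_prop)
    have h2 : Measurable fun p : (EuclideanSpace ℝ ι × EuclideanSpace ℝ ι × (ι → ℝ)) × Ξ =>
        (p.1.2.2, g p.1.1 - γ p.1.1 p.2) :=
      (by fun_prop : Measurable fun p : (EuclideanSpace ℝ ι × EuclideanSpace ℝ ι × (ι → ℝ)) × Ξ =>
        p.1.2.2).prodMk ((hg.comp (by fun_prop)).sub h1)
    exact ((hA.comp measurable_fst).add
      ((measurable_maskMul.comp h2).const_smul β)).norm.pow_const 2
  have hAn : ∀ ω, ‖A (Y ω)‖ ^ 2 = (1 - β) ^ 2 * ‖maskMul (u j ω) (g (X t ω) - M t ω)‖ ^ 2 := by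
    intro ω
    simp only [hAdef, hYdef, norm_smul, mul_pow, Real.norm_eq_abs, sq_abs]
  have hv := h.variance_nonneg
  have hmaskset : MeasurableSet {y : EuclideanSpace ℝ ι × EuclideanSpace ℝ ι × (ι → ℝ) |
      IsMask y.2.2} := by
    have : {y : EuclideanSpace ℝ ι × EuclideanSpace ℝ ι × (ι → ℝ) | IsMask y.2.2}
        = ⋂ i, {y | y.2.2 i = 0} ∪ {y | y.2.2 i = 1} := by
      ext y; simp [IsMask]
    rw [this]
    refine MeasurableSet.iInter fun i => MeasurableSet.union ?_ ?_
    · exact measurableSet_eq_fun (by fun_prop) measurable_const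
    · exact measurableSet_eq_fun (by fun_prop) measurable_const
  have hlint : ∫⁻ ω, ENNReal.ofReal (H (Y ω, ξ t ω)) ∂μ
      ≤ ENNReal.ofReal (∫ ω, (1 - β) ^ 2 * ‖maskMul (u j ω) (g (X t ω) - M t ω)‖ ^ 2 ∂μ
        + β ^ 2 * v) := by
    -- The joint law of state and sample is a product, so the sample can be integrated out first,
    -- for each fixed value of the state.
    have hlaw := (indepFun_iff_map_prod_eq_prod_map_map hY.aemeasurable
      (h.measurable_ξ t).aemeasurable).1 (h.indep_ξ t)
    rw [h.law_ξ] at hlaw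
    calc ∫⁻ ω, ENNReal.ofReal (H (Y ω, ξ t ω)) ∂μ
        = ∫⁻ p, ENNReal.ofReal (H p) ∂(μ.map fun ω => (Y ω, ξ t ω)) :=
          (lintegral_map hH.ennreal_ofReal (hY.prodMk (h.measurable_ξ t))).symm
      _ = ∫⁻ y, ∫⁻ z, ENNReal.ofReal (H (y, z)) ∂D ∂(μ.map Y) := by
          rw [hlaw, lintegral_prod _ hH.ennreal_ofReal.aemeasurable]
      _ ≤ ∫⁻ y, ENNReal.ofReal (‖A y‖ ^ 2 + β ^ 2 * v) ∂(μ.map Y) := by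
          refine lintegral_mono_ae ?_
          filter_upwards [(ae_map_iff hY.aemeasurable hmaskset).2 (h.isMask j)] with y hy
          exact h.noise_bound y.1 hy (A y)
      _ = ∫⁻ ω, ENNReal.ofReal (‖A (Y ω)‖ ^ 2 + β ^ 2 * v) ∂μ :=
          lintegral_map (by fun_prop) hY
      _ = ENNReal.ofReal (∫ ω, (‖A (Y ω)‖ ^ 2 + β ^ 2 * v) ∂μ) := by
          rw [ofReal_integral_eq_lintegral_ofReal]
          · simp only [hAn]
            exact hA2.add (integrable_const _)
          · exact ae_of_all _ fun ω => by positivity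
      _ = _ := by
          simp only [hAn]
          rw [integral_add hA2 (integrable_const _)]
          simp
  have hHe : ∀ ω, H (Y ω, ξ t ω) = ‖maskMul (u j ω) (g (X t ω)) - M (t + 1) ω‖ ^ 2 := by
    intro ω
    rw [h.error_eq]
  have := integrable_norm_sq_of_lintegral (hH.comp (hY.prodMk (h.measurable_ξ t)))
    (fun ω => sq_nonneg _)
    (add_nonneg (integral_nonneg fun ω => by positivity) (by positivity)) hlint
  simpa only [Function.comp_def, hHe] using this

/-- Moments at time t make the error of the next momentum square integrable; subtracting that error
from the masked gradient gives the momentum, and then the iterate, at time t + 1. -/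
lemma memLp_X_M (t : ℕ) : MemLp (X t) 2 μ ∧ MemLp (M t) 2 μ := by
  induction t with
  | zero =>
    rw [show X 0 = fun _ => x₀ from funext h.X_zero, show M 0 = fun _ => 0 from funext h.M_zero]
    exact ⟨memLp_const _, memLp_const _⟩
  | succ t ih =>
    obtain ⟨hX, hM⟩ := ih
    have hP := h.memLp_mask (h.memLp_g hX) (h.measurable_g.comp (h.measurable_X t)) (t / τ)
    have hPm : Measurable fun ω => maskMul (u (t / τ) ω) (g (X t ω)) :=
      measurable_maskMul.comp
        ((h.measurable_u _).prodMk (h.measurable_g.comp (h.measurable_X t)))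
    have he : MemLp (fun ω => maskMul (u (t / τ) ω) (g (X t ω)) - M (t + 1) ω) 2 μ :=
      (memLp_two_iff_integrable_sq_norm
        (hPm.sub (h.measurable_M (t + 1))).aestronglyMeasurable).2 (h.error_bound hX hM).1
    have hM' : MemLp (M (t + 1)) 2 μ := by
      have := hP.sub he
      simpa [Pi.sub_def] using this
    refine ⟨?_, hM'⟩
    exact (hX.sub (hM'.const_smul η)).ae_eq ((h.X_succ_ae t).mono fun ω hω => hω.symm)

end

end IsMaskedMSGD

end GoSare

/-! ### One-step inequalities in expectation -/

namespace GoSare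

open MeasureTheory ProbabilityTheory

namespace IsMaskedMSGD

variable {ι Ξ Ω : Type*} [Fintype ι] [MeasurableSpace Ξ] [MeasurableSpace Ω]
  {D : Measure Ξ} {μ : Measure Ω}
  {f : EuclideanSpace ℝ ι → ℝ} {g : EuclideanSpace ℝ ι → EuclideanSpace ℝ ι}
  {γ : EuclideanSpace ℝ ι → Ξ → EuclideanSpace ℝ ι} {L v δ c β η : ℝ} {τ : ℕ}
  {x₀ : EuclideanSpace ℝ ι} {ξ : ℕ → Ω → Ξ} {u : ℕ → Ω → ι → ℝ}
  {X M : ℕ → Ω → EuclideanSpace ℝ ι}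
  (h : IsMaskedMSGD D μ f g γ L v δ c β η τ x₀ ξ u X M)
include h

lemma measurable_gX (t : ℕ) : Measurable fun ω => g (X t ω) :=
  h.measurable_g.comp (h.measurable_X t)

lemma norm_grad_sub_le {t : ℕ} (hη : 0 ≤ η) :
    ∀ᵐ ω ∂μ, ‖g (X (t + 1) ω) - g (X t ω)‖ ≤ L * (η * ‖M (t + 1) ω‖) := by
  filter_upwards [h.X_succ_ae t] with ω hω
  refine (h.lipschitz _ _).trans_eq ?_
  rw [hω, sub_sub_cancel_left, norm_neg, norm_smul, Real.norm_of_nonneg hη]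

lemma norm_sq_grad_drift_le (j r : ℕ) (hr : r < τ) :
    ∀ᵐ ω ∂μ, ‖g (X (j * τ + r) ω) - g (X (j * τ) ω)‖ ^ 2
      ≤ L ^ 2 * η ^ 2 * τ * ∑ s ∈ Finset.range τ, ‖M (j * τ + s + 1) ω‖ ^ 2 := by
  filter_upwards [ae_all_iff.2 h.X_succ_ae] with ω hω
  have h1 := drift_le (x := fun t => X (j * τ + t) ω) (Mm := fun t => M (j * τ + t + 1) ω)
    (η := η) (fun t => hω (j * τ + t)) hr
  have h2 := pow_le_pow_left₀ (norm_nonneg _) (h.lipschitz (X (j * τ + r) ω) (X (j * τ) ω)) 2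
  rw [mul_pow] at h2
  refine h2.trans ?_
  rw [mul_assoc (L ^ 2), mul_assoc (L ^ 2)]
  exact mul_le_mul_of_nonneg_left h1 (sq_nonneg L)

variable [IsProbabilityMeasure D] [IsProbabilityMeasure μ]

lemma memLp_gX (t : ℕ) : MemLp (fun ω => g (X t ω)) 2 μ := h.memLp_g (h.memLp_X_M t).1

lemma integrable_grad (t : ℕ) : Integrable (fun ω => ‖g (X t ω)‖ ^ 2) μ :=
  (h.memLp_gX t).integrable_norm_pow (by norm_num)

lemma integrable_mask_grad (t j : ℕ) :
    Integrable (fun ω => ‖maskMul (u j ω) (g (X t ω))‖ ^ 2) μ :=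
  (h.memLp_mask (h.memLp_gX t) (h.measurable_gX t) j).integrable_norm_pow (by norm_num)

lemma integrable_momentum (t : ℕ) : Integrable (fun ω => ‖M t ω‖ ^ 2) μ :=
  (h.memLp_X_M t).2.integrable_norm_pow (by norm_num)

lemma integrable_error (t : ℕ) :
    Integrable (fun ω => ‖maskMul (u (t / τ) ω) (g (X t ω)) - M (t + 1) ω‖ ^ 2) μ :=
  (h.error_bound (h.memLp_X_M t).1 (h.memLp_X_M t).2).1

lemma integrable_momentum_error (t : ℕ) :
    Integrable (fun ω => (1 - β) ^ 2 * ‖maskMul (u (t / τ) ω) (g (X t ω) - M t ω)‖ ^ 2) μ :=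
  ((h.memLp_mask ((h.memLp_gX t).sub (h.memLp_X_M t).2)
    ((h.measurable_gX t).sub (h.measurable_M t)) _).integrable_norm_pow (by norm_num)).const_mul _

/-- f lies between the constant c and its quadratic upper bound at x₀, so second moments of X t
suffice. -/
lemma integrable_objective (t : ℕ) : Integrable (fun ω => f (X t ω)) μ := by
  have hx : Integrable (fun ω => ‖X t ω - x₀‖) μ :=
    (((h.memLp_X_M t).1.sub (memLp_const x₀)).integrable one_le_two).norm
  have hx2 : Integrable (fun ω => ‖X t ω - x₀‖ ^ 2) μ :=
    ((h.memLp_X_M t).1.sub (memLp_const x₀)).integrable_norm_pow (by norm_num)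
  refine ((((integrable_const (|f x₀| + |c|)).add (hx.const_mul ‖g x₀‖)).add
    (hx2.const_mul (|L| / 2)))).mono'
    (h.measurable_f.comp (h.measurable_X t)).aestronglyMeasurable (ae_of_all _ fun ω => ?_)
  have h1 := h.quadratic x₀ (X t ω)
  have h2 := h.bounded_below (X t ω)
  have h3 := real_inner_le_norm (g x₀) (X t ω - x₀)
  have h4 : L / 2 * ‖X t ω - x₀‖ ^ 2 ≤ |L| / 2 * ‖X t ω - x₀‖ ^ 2 := by
    gcongr; exact le_abs_self L
  have h5 : 0 ≤ |L| / 2 * ‖X t ω - x₀‖ ^ 2 := by positivity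
  have h6 : 0 ≤ ‖g x₀‖ * ‖X t ω - x₀‖ := by positivity
  simp only [Pi.add_apply]
  rw [Real.norm_eq_abs, abs_le]
  constructor
  · linarith [neg_abs_le c, abs_nonneg (f x₀)]
  · linarith [le_abs_self (f x₀), abs_nonneg c]

/-- A freshly drawn mask retains at least a fraction `δ` of the expected squared gradient norm. -/
lemma mask_grad_ge (j : ℕ) :
    δ * ∫ ω, ‖g (X (j * τ) ω)‖ ^ 2 ∂μ
      ≤ ∫ ω, ‖maskMul (u j ω) (g (X (j * τ) ω))‖ ^ 2 ∂μ := by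
  have hgi : ∀ i, Integrable (fun ω => g (X (j * τ) ω) i ^ 2) μ := fun i => by
    refine (h.integrable_grad (j * τ)).mono' ?_ (ae_of_all _ fun ω => ?_)
    · exact (((EuclideanSpace.proj (𝕜 := ℝ) i).continuous.measurable.comp
        (h.measurable_gX _)).pow_const 2).aestronglyMeasurable
    · rw [Real.norm_of_nonneg (sq_nonneg _), EuclideanSpace.real_norm_sq_eq]
      exact Finset.single_le_sum (f := fun i => g (X (j * τ) ω) i ^ 2)
        (fun _ _ => sq_nonneg _) (Finset.mem_univ i)
  have hum : ∀ i, Measurable fun ω => u j ω i := fun i => (measurable_pi_apply i).comp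
    (h.measurable_u j)
  have hugi : ∀ i, Integrable (fun ω => u j ω i * g (X (j * τ) ω) i ^ 2) μ := fun i => by
    refine (hgi i).mono' ((hum i).aestronglyMeasurable.mul (hgi i).aestronglyMeasurable) ?_
    filter_upwards [h.isMask j] with ω hω
    rcases hω i with h0 | h0 <;> simp [h0, sq_nonneg]
  -- Independence factorizes each coordinate separately, so only the marginal means of the mask
  -- entries matter, not their joint law.
  have hmul : ∀ i, ∫ ω, u j ω i * g (X (j * τ) ω) i ^ 2 ∂μ
      = (∫ ω, u j ω i ∂μ) * ∫ ω, g (X (j * τ) ω) i ^ 2 ∂μ := fun i => by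
    have hφ : Measurable fun x : EuclideanSpace ℝ ι => g x i ^ 2 :=
      ((EuclideanSpace.proj (𝕜 := ℝ) i).continuous.measurable.comp h.measurable_g).pow_const 2
    have hind : IndepFun (fun ω => u j ω i) (fun ω => g (X (j * τ) ω) i ^ 2) μ :=
      ((h.indep_u j i).comp hφ measurable_id).symm
    exact hind.integral_fun_mul_eq_mul_integral (hum i).aestronglyMeasurable
      (hgi i).aestronglyMeasurable
  calc δ * ∫ ω, ‖g (X (j * τ) ω)‖ ^ 2 ∂μ
      = ∑ i, δ * ∫ ω, g (X (j * τ) ω) i ^ 2 ∂μ := by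
        simp only [EuclideanSpace.real_norm_sq_eq]
        rw [integral_finsetSum _ fun i _ => hgi i, Finset.mul_sum]
    _ ≤ ∑ i, (∫ ω, u j ω i ∂μ) * ∫ ω, g (X (j * τ) ω) i ^ 2 ∂μ := by
        refine Finset.sum_le_sum fun i _ => ?_
        exact mul_le_mul_of_nonneg_right (h.mask_mean j i)
          (integral_nonneg fun ω => sq_nonneg _)
    _ = ∫ ω, ∑ i, u j ω i * g (X (j * τ) ω) i ^ 2 ∂μ := by
        rw [integral_finsetSum _ fun i _ => hugi i]
        exact Finset.sum_congr rfl fun i _ => (hmul i).symm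
    _ = _ := by
        refine integral_congr_ae ?_
        filter_upwards [h.isMask j] with ω hω
        rw [norm_sq_maskMul hω]

/-- Since the momentum starts at zero, iteration 0 behaves like a mask change; its cost is the term
a 0 that τ ∣ 0 provides when the errors are summed. -/
lemma error_zero :
    ∫ ω, ‖maskMul (u (0 / τ) ω) (g (X 0 ω)) - M (0 + 1) ω‖ ^ 2 ∂μ
      ≤ (1 - β) ^ 2 * ∫ ω, ‖g (X 0 ω)‖ ^ 2 ∂μ + β ^ 2 * v := by
  refine (h.error_bound (h.memLp_X_M 0).1 (h.memLp_X_M 0).2).2.trans ?_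
  rw [← integral_const_mul]
  refine add_le_add_left (integral_mono_ae (h.integrable_momentum_error 0)
    ((h.integrable_grad 0).const_mul _) ?_) _
  filter_upwards [h.isMask (0 / τ)] with ω hω
  rw [h.M_zero, sub_zero]
  exact mul_le_mul_of_nonneg_left (norm_sq_maskMul_le hω _) (sq_nonneg _)

/-- t / τ jumps exactly when τ ∣ t + 1; in the other case the mask is the same and the last term is
absent. -/
lemma error_succ (hβ : 0 < β) (hβ1 : β ≤ 1) (hη : 0 ≤ η) (t : ℕ) :
    ∫ ω, ‖maskMul (u ((t + 1) / τ) ω) (g (X (t + 1) ω)) - M (t + 1 + 1) ω‖ ^ 2 ∂μ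
      ≤ (1 - β) * ∫ ω, ‖maskMul (u (t / τ) ω) (g (X t ω)) - M (t + 1) ω‖ ^ 2 ∂μ
        + L ^ 2 * η ^ 2 / β * ∫ ω, ‖M (t + 1) ω‖ ^ 2 ∂μ + β ^ 2 * v
        + if τ ∣ t + 1 then ∫ ω, ‖g (X (t + 1) ω)‖ ^ 2 ∂μ else 0 := by
  refine (h.error_bound (h.memLp_X_M _).1 (h.memLp_X_M _).2).2.trans ?_
  have he := (h.integrable_error t).const_mul (1 - β)
  have hm := (h.integrable_momentum (t + 1)).const_mul (L ^ 2 * η ^ 2 / β)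
  rw [← integral_const_mul (1 - β), ← integral_const_mul (L ^ 2 * η ^ 2 / β),
    add_right_comm _ (β ^ 2 * v)]
  refine add_le_add_left ?_ _
  split_ifs with hdvd
  · rw [← integral_add' he hm, ← integral_add' (he.add hm) (h.integrable_grad _)]
    refine integral_mono_ae (h.integrable_momentum_error _)
      ((he.add hm).add (h.integrable_grad _)) ?_
    filter_upwards [h.isMask (t / τ), h.isMask ((t + 1) / τ), h.mask_M_succ t,
      h.norm_grad_sub_le hη (t := t)] with ω h1 h2 h3 h4
    exact momentum_error_change hβ hβ1 h1 h2 h3 h4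
  · have hdiv : (t + 1) / τ = t / τ := by rw [Nat.succ_div, if_neg hdvd, add_zero]
    rw [add_zero, ← integral_add he hm]
    refine integral_mono_ae (h.integrable_momentum_error _) (he.add hm) ?_
    filter_upwards [h.isMask (t / τ), h.mask_M_succ t,
      h.norm_grad_sub_le hη (t := t)] with ω h1 h3 h4
    rw [hdiv]
    exact momentum_error_same hβ hβ1 h1 h3 h4

lemma objective_succ (t : ℕ) :
    ∫ ω, f (X (t + 1) ω) ∂μ ≤ ∫ ω, f (X t ω) ∂μ
      - η / 2 * ∫ ω, ‖maskMul (u (t / τ) ω) (g (X t ω))‖ ^ 2 ∂μ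
      - η / 2 * (1 - L * η) * ∫ ω, ‖M (t + 1) ω‖ ^ 2 ∂μ
      + η / 2 * ∫ ω, ‖maskMul (u (t / τ) ω) (g (X t ω)) - M (t + 1) ω‖ ^ 2 ∂μ := by
  have h0 := h.integrable_objective t
  have h1 := (h.integrable_mask_grad t (t / τ)).const_mul (η / 2)
  have h2 := (h.integrable_momentum (t + 1)).const_mul (η / 2 * (1 - L * η))
  have h3 := (h.integrable_error t).const_mul (η / 2)
  rw [← integral_const_mul (η / 2), ← integral_const_mul (η / 2 * (1 - L * η)),
    ← integral_const_mul (η / 2), ← integral_sub' h0 h1, ← integral_sub' (h0.sub h1) h2,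
    ← integral_add' ((h0.sub h1).sub h2) h3]
  refine integral_mono_ae (h.integrable_objective _) (((h0.sub h1).sub h2).add h3) ?_
  filter_upwards [h.mask_M_succ t, h.X_succ_ae t] with ω hM hX
  refine descent_step hM ?_
  have := h.quadratic (X t ω) (X (t + 1) ω)
  rwa [show X (t + 1) ω - X t ω = -(η • M (t + 1) ω) by rw [hX]; abel] at this

lemma integrable_drift (j : ℕ) :
    Integrable (fun ω => L ^ 2 * η ^ 2 * τ * ∑ s ∈ Finset.range τ, ‖M (j * τ + s + 1) ω‖ ^ 2) μ :=
  (integrable_finsetSum _ fun s _ => h.integrable_momentum (j * τ + s + 1)).const_mul _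

lemma integral_drift (j : ℕ) :
    ∫ ω, L ^ 2 * η ^ 2 * τ * ∑ s ∈ Finset.range τ, ‖M (j * τ + s + 1) ω‖ ^ 2 ∂μ
      = L ^ 2 * η ^ 2 * τ * ∑ s ∈ Finset.range τ, ∫ ω, ‖M (j * τ + s + 1) ω‖ ^ 2 ∂μ := by
  rw [integral_const_mul, integral_finsetSum _ fun s _ => h.integrable_momentum (j * τ + s + 1)]

/-- The factor δ is available only at the period start, before the iterate depends on the mask.
Since the mask stays fixed, the drift of the gradient carries the bound through the period, at the
price of half of δ. -/
lemma mask_grad_period (j r : ℕ) (hr : r < τ) :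
    δ / 2 * ∫ ω, ‖g (X (j * τ) ω)‖ ^ 2 ∂μ
        - L ^ 2 * η ^ 2 * τ * ∑ s ∈ Finset.range τ, ∫ ω, ‖M (j * τ + s + 1) ω‖ ^ 2 ∂μ
      ≤ ∫ ω, ‖maskMul (u ((j * τ + r) / τ) ω) (g (X (j * τ + r) ω))‖ ^ 2 ∂μ := by
  have hdiv : (j * τ + r) / τ = j := by
    rw [mul_comm, Nat.mul_add_div (by omega), Nat.div_eq_of_lt hr, add_zero]
  rw [hdiv, ← h.integral_drift j]
  have hi := (h.integrable_mask_grad (j * τ) j).const_mul (1 / 2)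
  have h1 : ∫ ω, (1 / 2 * ‖maskMul (u j ω) (g (X (j * τ) ω))‖ ^ 2
      - L ^ 2 * η ^ 2 * τ * ∑ s ∈ Finset.range τ, ‖M (j * τ + s + 1) ω‖ ^ 2) ∂μ
      ≤ ∫ ω, ‖maskMul (u j ω) (g (X (j * τ + r) ω))‖ ^ 2 ∂μ := by
    refine integral_mono_ae (hi.sub (h.integrable_drift j)) (h.integrable_mask_grad _ _) ?_
    filter_upwards [h.isMask j, h.norm_sq_grad_drift_le j r hr] with ω h1 h2
    have h3 := half_norm_sq_le (maskMul (u j ω) (g (X (j * τ) ω)))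
      (maskMul (u j ω) (g (X (j * τ + r) ω)))
    rw [← maskMul_sub] at h3
    have h4 := norm_sq_maskMul_le h1 (g (X (j * τ + r) ω) - g (X (j * τ) ω))
    linarith
  rw [integral_sub hi (h.integrable_drift j), integral_const_mul] at h1
  linarith [h.mask_grad_ge j]

lemma grad_period (j r : ℕ) (hr : r < τ) :
    ∫ ω, ‖g (X (j * τ + r) ω)‖ ^ 2 ∂μ
      ≤ 2 * ∫ ω, ‖g (X (j * τ) ω)‖ ^ 2 ∂μ + 2 * (L ^ 2 * η ^ 2 * τ
          * ∑ s ∈ Finset.range τ, ∫ ω, ‖M (j * τ + s + 1) ω‖ ^ 2 ∂μ) := by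
  rw [← h.integral_drift j]
  have h0 := (h.integrable_grad (j * τ)).const_mul 2
  have h1 := (h.integrable_drift j).const_mul 2
  rw [← integral_const_mul 2, ← integral_const_mul 2, ← integral_add h0 h1]
  refine integral_mono_ae (h.integrable_grad _) (h0.add h1) ?_
  filter_upwards [h.norm_sq_grad_drift_le j r hr] with ω h2
  have h3 := half_norm_sq_le (g (X (j * τ + r) ω)) (g (X (j * τ) ω))
  rw [norm_sub_rev] at h3
  linarith

/-- The sum of the expected squared gradient norms over `K` periods. -/
theorem sum_integral_grad_le (hβ : 0 < β) (hβ1 : β ≤ 1) (hδ : 0 < δ) (hδ1 : δ ≤ 1) (hη : 0 < η)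
    (hL : 0 < L) (hτ : 64 / (3 * β * δ) ≤ (τ : ℝ)) (hη1 : L * η ≤ 1 / 4)
    (hη2 : L ^ 2 * η ^ 2 ≤ 3 * δ * β ^ 2 / 80) (hη3 : L ^ 2 * η ^ 2 * τ ^ 2 ≤ 3 * δ / 80)
    {K : ℕ} (hK : 1 ≤ K) :
    ∑ t ∈ Finset.range (K * τ), ∫ ω, ‖g (X t ω)‖ ^ 2 ∂μ
      ≤ 16 * (f x₀ - c) / (δ * η) + 32 * β * v / (3 * δ) * (K * τ) := by
  refine sum_grad_le _ (fun t => ∫ ω, ‖maskMul (u (t / τ) ω) (g (X t ω))‖ ^ 2 ∂μ)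
    (fun t => ∫ ω, ‖M (t + 1) ω‖ ^ 2 ∂μ)
    (fun t => ∫ ω, ‖maskMul (u (t / τ) ω) (g (X t ω)) - M (t + 1) ω‖ ^ 2 ∂μ)
    (fun t => ∫ ω, f (X t ω) ∂μ) hβ hβ1 hδ hδ1 hη hL h.variance_nonneg hτ hK hη1 hη2 hη3
    (fun t => integral_nonneg fun _ => sq_nonneg _) (fun t => integral_nonneg fun _ => sq_nonneg _)
    (fun t => integral_nonneg fun _ => sq_nonneg _) ?_ (h.error_succ hβ hβ1 hη.le) ?_ ?_
    h.objective_succ h.mask_grad_period h.grad_period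
  · refine h.error_zero.trans (add_le_add_left ?_ _)
    exact mul_le_of_le_one_left (integral_nonneg fun _ => sq_nonneg _)
      (pow_le_one₀ (by linarith) (by linarith))
  · simp [h.X_zero]
  · intro t
    have := integral_mono (integrable_const c) (h.integrable_objective t)
      fun ω => h.bounded_below (X t ω)
    simpa using this

end IsMaskedMSGD

end GoSare

/-! ### Entry means of uniform masks, and coordinates -/

namespace GoSare

open MeasureTheory ProbabilityTheory

section UniformMasks

variable {a b k : ℕ}

instance (a b : ℕ) : MeasurableSingletonClass (Matrix (Fin a) (Fin b) ℝ) :=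
  inferInstanceAs (MeasurableSingletonClass (Fin a → Fin b → ℝ))

lemma measurable_entry (i : Fin a) (j : Fin b) :
    Measurable fun S : Matrix (Fin a) (Fin b) ℝ => S i j :=
  (measurable_pi_apply j).comp
    (measurable_pi_apply (X := fun _ : Fin a => Fin b → ℝ) i)

lemma frobSq_eq_sum_prod (S : Matrix (Fin a) (Fin b) ℝ) :
    frobSq S = ∑ p : Fin a × Fin b, S p.1 p.2 ^ 2 :=
  (Fintype.sum_prod_type' fun i j => S i j ^ 2).symm

lemma finite_sparseMasks : (sparseMasks a b k).Finite := by
  have h : (Set.pi Set.univ fun _ : Fin a => Set.pi Set.univ fun _ : Fin b =>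
      ({0, 1} : Set ℝ)).Finite :=
    Set.Finite.pi fun _ => Set.Finite.pi fun _ => Set.toFinite _
  refine h.subset fun S hS => ?_
  simpa [Set.mem_pi] using hS.1

/-- All entries of a uniform sparse mask have the same mean. -/
lemma sum_sparseMasks_entry_eq (p q : Fin a × Fin b) :
    ∑ S ∈ (finite_sparseMasks (a := a) (b := b) (k := k)).toFinset, S p.1 p.2
      = ∑ S ∈ (finite_sparseMasks (a := a) (b := b) (k := k)).toFinset, S q.1 q.2 := by
  -- Exchanging two positions is an involution of the set of masks, and it exchanges the two
  -- entries.
  set e := Equiv.swap p q with he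
  let Φ : Matrix (Fin a) (Fin b) ℝ → Matrix (Fin a) (Fin b) ℝ :=
    fun S => Matrix.of fun i j => S (e (i, j)).1 (e (i, j)).2
  have hΦ : ∀ S, S ∈ sparseMasks a b k → Φ S ∈ sparseMasks a b k := by
    intro S hS
    refine ⟨fun i j => hS.1 _ _, ?_⟩
    rw [← hS.2, frobSq_eq_sum_prod, frobSq_eq_sum_prod]
    exact Equiv.sum_comp e fun r => S r.1 r.2 ^ 2
  have hinv : ∀ S, Φ (Φ S) = S := by
    intro S
    ext i j
    simp [Φ, he]
  refine Finset.sum_bij' (fun S _ => Φ S) (fun S _ => Φ S) ?_ ?_ ?_ ?_ ?_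
  · intro S hS
    simpa using hΦ S (by simpa using hS)
  · intro S hS
    simpa using hΦ S (by simpa using hS)
  · intro S _; exact hinv S
  · intro S _; exact hinv S
  · intro S _
    simp [Φ, he]

lemma integral_uniformOn_sparseMasks (f : Matrix (Fin a) (Fin b) ℝ → ℝ) :
    ∫ S, f S ∂(uniformOn (sparseMasks a b k))
      = ((sparseMasks a b k).ncard : ℝ)⁻¹
        * ∑ S ∈ (finite_sparseMasks (a := a) (b := b) (k := k)).toFinset, f S := by
  have hc : (sparseMasks a b k) = ((finite_sparseMasks (a := a) (b := b) (k := k)).toFinset :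
      Set (Matrix (Fin a) (Fin b) ℝ)) := by simp
  rw [uniformOn, ProbabilityTheory.cond, integral_smul_measure]
  conv_lhs => rw [hc]
  rw [setIntegral_finset]
  swap
  · rw [← Set.biUnion_of_singleton ((finite_sparseMasks (a := a) (b := b) (k := k)).toFinset :
      Set (Matrix (Fin a) (Fin b) ℝ))]
    exact integrableOn_finset_iUnion.2 fun _ _ => integrableOn_singleton (hx := by simp)
  simp only [smul_eq_mul, Measure.real, Measure.count_singleton, ENNReal.toReal_one, one_mul,
    ENNReal.toReal_inv]
  rw [Measure.count_apply_finset, Set.ncard_eq_toFinset_card _ finite_sparseMasks]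
  simp

/-- The mean of an entry of a uniform sparse mask. -/
lemma integral_entry_sparseMasks [IsProbabilityMeasure (uniformOn (sparseMasks a b k))]
    (i : Fin a) (j : Fin b) :
    ∫ S, S i j ∂(uniformOn (sparseMasks a b k)) = k / (a * b) := by
  -- `uniformOn` of the empty set has mass zero, contrary to its being a probability measure.
  have hne : (sparseMasks a b k).Nonempty := by
    rw [Set.nonempty_iff_ne_empty]
    intro h0
    have := measure_univ (μ := uniformOn (sparseMasks a b k))
    rw [h0] at this
    simp at this
  set Fs := (finite_sparseMasks (a := a) (b := b) (k := k)).toFinset with hFs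
  have hcard : (sparseMasks a b k).ncard = Fs.card :=
    Set.ncard_eq_toFinset_card _ finite_sparseMasks
  have hpos : (0 : ℝ) < Fs.card := by
    rw [← hcard]
    exact_mod_cast (Set.ncard_pos finite_sparseMasks).2 hne
  have hab : (0 : ℝ) < a * b :=
    mul_pos (by exact_mod_cast i.pos) (by exact_mod_cast j.pos)
  -- Double counting: all a * b positions have the same entry sum over the masks, and each mask has
  -- k ones.
  have hsum : (a * b : ℝ) * ∑ S ∈ Fs, S i j = Fs.card * k := by
    calc (a * b : ℝ) * ∑ S ∈ Fs, S i j = ∑ p : Fin a × Fin b, ∑ S ∈ Fs, S p.1 p.2 := by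
          rw [Finset.sum_congr rfl fun p _ => sum_sparseMasks_entry_eq p (i, j)]
          simp [hFs]
      _ = ∑ S ∈ Fs, ∑ p : Fin a × Fin b, S p.1 p.2 := Finset.sum_comm
      _ = ∑ S ∈ Fs, (k : ℝ) := by
          refine Finset.sum_congr rfl fun S hS => ?_
          have hS' : S ∈ sparseMasks a b k := by simpa [hFs] using hS
          rw [← hS'.2, frobSq_eq_sum_prod]
          refine Finset.sum_congr rfl fun p _ => ?_
          rcases hS'.1 p.1 p.2 with h | h <;> simp [h]
      _ = Fs.card * k := by simp
  rw [integral_uniformOn_sparseMasks, hcard, ← hFs]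
  rw [eq_div_iff hab.ne', mul_comm, mul_left_comm, hsum]
  field_simp

end UniformMasks

section Coordinates

variable {N : ℕ} {m n : Fin N → ℕ}

lemma sum_frobSq_layer (x : Params m n) : ∑ ℓ, frobSq (layer x ℓ) = ‖x‖ ^ 2 := by
  rw [EuclideanSpace.real_norm_sq_eq, Fintype.sum_sigma]
  exact Finset.sum_congr rfl fun ℓ _ => frobSq_eq_sum_prod _

/-- The family of masks as a function on the coordinates of the parameter space. -/
def flatMask (U : Layers m n) : ((ℓ : Fin N) × (Fin (m ℓ) × Fin (n ℓ))) → ℝ :=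
  fun p => U p.1 p.2.1 p.2.2

lemma minDensity_le (k : Fin N → ℕ) (ℓ : Fin N) :
    minDensity m n k ≤ (k ℓ : ℝ) / ((m ℓ : ℝ) * (n ℓ : ℝ)) :=
  ciInf_le (Set.finite_range _).bddBelow ℓ

lemma minDensity_pos_le_one {k : Fin N → ℕ} (hN : 0 < N) (hk : ∀ ℓ, 1 ≤ k ℓ)
    (hk' : ∀ ℓ, k ℓ ≤ m ℓ * n ℓ) : 0 < minDensity m n k ∧ minDensity m n k ≤ 1 := by
  have : Nonempty (Fin N) := ⟨⟨0, hN⟩⟩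
  have hmn : ∀ ℓ, (0 : ℝ) < (m ℓ : ℝ) * (n ℓ : ℝ) := fun ℓ => by
    exact_mod_cast (hk ℓ).trans (hk' ℓ)
  constructor
  · obtain ⟨ℓ, hℓ⟩ := exists_eq_ciInf_of_finite
      (f := fun ℓ => (k ℓ : ℝ) / ((m ℓ : ℝ) * (n ℓ : ℝ)))
    rw [minDensity, ← hℓ]
    exact div_pos (by exact_mod_cast hk ℓ) (hmn ℓ)
  · refine (minDensity_le k ⟨0, hN⟩).trans ((div_le_one (hmn _)).2 ?_)
    exact_mod_cast hk' ⟨0, hN⟩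

end Coordinates

end GoSare

/-! ### GoSare as masked momentum SGD -/

namespace GoSare

open MeasureTheory ProbabilityTheory

variable {N : ℕ} {m n k : Fin N → ℕ} {Ξ Ω : Type*}

section Gradient

variable [MeasurableSpace Ξ] {D : Measure Ξ} {F : Params m n → Ξ → ℝ} {σ : Fin N → ℝ}

lemma sum_frobSq_layerGrad_sub (x : Params m n) (s : Ξ) :
    ∑ ℓ, frobSq (layerGrad (fun y => F y s) x ℓ - layerGrad (objective F D) x ℓ)
      = ‖gradient (fun y => F y s) x - gradient (objective F D) x‖ ^ 2 :=
  sum_frobSq_layer (gradient (fun y => F y s) x - gradient (objective F D) x)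

lemma IsLoss.measurable_gradient_apply (hF : IsLoss F D) (x : Params m n) :
    Measurable fun s => gradient (fun y => F y s) x :=
  hF.measurable_gradient.comp (f := fun s : Ξ => (x, s)) (by fun_prop)

lemma StochasticGradient.integrable_norm_sq (hG : StochasticGradient F D σ) (x : Params m n) :
    Integrable (fun s => ‖gradient (fun y => F y s) x - gradient (objective F D) x‖ ^ 2) D := by
  simp only [← sum_frobSq_layerGrad_sub]
  exact integrable_finsetSum _ fun ℓ _ => hG.integrable_sq x ℓ

lemma StochasticGradient.integral_norm_sq_le (hG : StochasticGradient F D σ) (x : Params m n) :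
    ∫ s, ‖gradient (fun y => F y s) x - gradient (objective F D) x‖ ^ 2 ∂D
      ≤ totalNoise σ ^ 2 := by
  simp only [← sum_frobSq_layerGrad_sub]
  rw [integral_finsetSum _ fun ℓ _ => hG.integrable_sq x ℓ, totalNoise,
    Real.sq_sqrt (Finset.sum_nonneg fun ℓ _ => sq_nonneg _)]
  exact Finset.sum_le_sum fun ℓ _ => hG.variance_le x ℓ

lemma StochasticGradient.integrable_gradient [IsProbabilityMeasure D] (hF : IsLoss F D)
    (hG : StochasticGradient F D σ) (x : Params m n) :
    Integrable (fun s => gradient (fun y => F y s) x) D := by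
  have h1 : MemLp (fun s => gradient (fun y => F y s) x - gradient (objective F D) x) 2 D :=
    (memLp_two_iff_integrable_sq_norm
      ((hF.measurable_gradient_apply x).sub_const _).aestronglyMeasurable).2
      (hG.integrable_norm_sq x)
  simpa [Pi.add_def] using
    (h1.integrable one_le_two).add (integrable_const (gradient (objective F D) x))

lemma StochasticGradient.integral_gradient [IsProbabilityMeasure D] (hF : IsLoss F D)
    (hG : StochasticGradient F D σ) (x : Params m n) :
    ∫ s, gradient (fun y => F y s) x ∂D = gradient (objective F D) x := by
  ext p
  have h := (EuclideanSpace.proj (𝕜 := ℝ) p).integral_comp_comm (hG.integrable_gradient hF x)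
  exact h.symm.trans (hG.unbiased x p.1 p.2.1 p.2.2)

end Gradient

section Recursion

variable (F : Params m n → Ξ → ℝ) (β : ℝ) (τ : ℕ) (η : ℝ) (x₀ : Params m n)
  (ξ : ℕ → Ω → Ξ) (U : ℕ → (ℓ : Fin N) → Ω → Matrix (Fin (m ℓ)) (Fin (n ℓ)) ℝ)

/-- A new mask is installed exactly when t / τ jumps, and iteration 0 installs `U 0`. For τ = 0 this
mask is kept forever, in agreement with t / 0 = 0. -/
lemma process_S_succ (t : ℕ) (ω : Ω) :
    (process F β τ η x₀ ξ U (t + 1) ω).S = fun ℓ => U (t / τ) ℓ ω := by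
  induction t with
  | zero => simp [process, run, step]
  | succ t ih =>
    by_cases h : (t + 1) % τ = 0
    · simp [process, run, step, h]
    · have h1 : (process F β τ η x₀ ξ U (t + 1 + 1) ω).S
          = (process F β τ η x₀ ξ U (t + 1) ω).S := by
        conv_lhs => unfold process; rw [run]
        simp only [step, if_neg h]
        rfl
      have h2 : (t + 1) / τ = t / τ := by
        rw [Nat.succ_div, if_neg (fun hd => h (Nat.mod_eq_zero_of_dvd hd)), add_zero]
      rw [h1, ih, h2]

/-- The mask in force in iteration `t`. -/
lemma mask_eq (t : ℕ) (ω : Ω) :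
    (if t % τ = 0 then fun ℓ => U (t / τ) ℓ ω else (process F β τ η x₀ ξ U t ω).S)
      = fun ℓ => U (t / τ) ℓ ω :=
  process_S_succ F β τ η x₀ ξ U t ω

lemma vec_process_M_succ (t : ℕ) (ω : Ω) :
    vec (process F β τ η x₀ ξ U (t + 1) ω).M
      = maskMul (flatMask fun ℓ => U (t / τ) ℓ ω)
          ((1 - β) • vec (process F β τ η x₀ ξ U t ω).M
            + β • gradient (fun y => F y (ξ t ω)) (process F β τ η x₀ ξ U t ω).x) := by
  ext p
  have hS := congrFun (congrFun (congrFun (mask_eq F β τ η x₀ ξ U t ω) p.1) p.2.1) p.2.2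
  change (1 - β) * ((if t % τ = 0 then fun ℓ => U (t / τ) ℓ ω
      else (process F β τ η x₀ ξ U t ω).S) p.1 p.2.1 p.2.2
        * (process F β τ η x₀ ξ U t ω).M p.1 p.2.1 p.2.2)
      + β * ((if t % τ = 0 then fun ℓ => U (t / τ) ℓ ω
      else (process F β τ η x₀ ξ U t ω).S) p.1 p.2.1 p.2.2
        * gradient (fun y => F y (ξ t ω)) (process F β τ η x₀ ξ U t ω).x p)
    = U (t / τ) p.1 ω p.2.1 p.2.2 * ((1 - β) * (process F β τ η x₀ ξ U t ω).M p.1 p.2.1 p.2.2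
        + β * gradient (fun y => F y (ξ t ω)) (process F β τ η x₀ ξ U t ω).x p)
  rw [hS]
  ring

lemma process_x_succ (t : ℕ) (ω : Ω) :
    (process F β τ η x₀ ξ U (t + 1) ω).x = (process F β τ η x₀ ξ U t ω).x
      - η • maskMul (flatMask fun ℓ => U (t / τ) ℓ ω)
          (vec (process F β τ η x₀ ξ U (t + 1) ω).M) := by
  ext p
  have hS := congrFun (congrFun (congrFun (mask_eq F β τ η x₀ ξ U t ω) p.1) p.2.1) p.2.2
  change (process F β τ η x₀ ξ U t ω).x p
      - η * ((if t % τ = 0 then fun ℓ => U (t / τ) ℓ ω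
        else (process F β τ η x₀ ξ U t ω).S) p.1 p.2.1 p.2.2
          * (process F β τ η x₀ ξ U (t + 1) ω).M p.1 p.2.1 p.2.2)
    = (process F β τ η x₀ ξ U t ω).x p - η * (U (t / τ) p.1 ω p.2.1 p.2.2
        * (process F β τ η x₀ ξ U (t + 1) ω).M p.1 p.2.1 p.2.2)
  rw [hS]

lemma process_calls (t : ℕ) (ω : Ω) : (process F β τ η x₀ ξ U t ω).calls = t := by
  induction t with
  | zero => rfl
  | succ t ih => exact congrArg (· + 1) ih

end Recursion

section Measurability

variable [MeasurableSpace Ξ] {F : Params m n → Ξ → ℝ}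
  {ξ : ℕ → Ω → Ξ} {U : ℕ → (ℓ : Fin N) → Ω → Matrix (Fin (m ℓ)) (Fin (n ℓ)) ℝ}

/-- The `σ`-algebras generated by the single draws of data and masks. -/
abbrev drawAlgebra (ξ : ℕ → Ω → Ξ) (U : ℕ → (ℓ : Fin N) → Ω → Matrix (Fin (m ℓ)) (Fin (n ℓ)) ℝ)
    (i : ℕ ⊕ (ℕ × Fin N)) : MeasurableSpace Ω :=
  Sum.elim (fun t => MeasurableSpace.comap (ξ t) inferInstance)
    (fun p => MeasurableSpace.comap (U p.1 p.2) inferInstance) i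

/-- The draws of data before iteration `t` and the mask draws with index in `J`. -/
def pastDraws (N t : ℕ) (J : Set ℕ) : Set (ℕ ⊕ (ℕ × Fin N)) :=
  {i | Sum.elim (fun s => s < t) (fun p => p.1 ∈ J) i}

/-- The `σ`-algebra generated by the draws in `A`. -/
abbrev drawsAlgebra (ξ : ℕ → Ω → Ξ) (U : ℕ → (ℓ : Fin N) → Ω → Matrix (Fin (m ℓ)) (Fin (n ℓ)) ℝ)
    (A : Set (ℕ ⊕ (ℕ × Fin N))) : MeasurableSpace Ω :=
  ⨆ i ∈ A, drawAlgebra ξ U i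

lemma drawsAlgebra_mono {A B : Set (ℕ ⊕ (ℕ × Fin N))} (h : A ⊆ B) :
    drawsAlgebra ξ U A ≤ drawsAlgebra ξ U B :=
  biSup_mono h

lemma measurable_data_drawsAlgebra {A : Set (ℕ ⊕ (ℕ × Fin N))} {t : ℕ} (h : Sum.inl t ∈ A) :
    Measurable[drawsAlgebra ξ U A] (ξ t) :=
  (comap_measurable (ξ t)).mono (le_biSup (drawAlgebra ξ U) h) le_rfl

lemma measurable_mask_drawsAlgebra {A : Set (ℕ ⊕ (ℕ × Fin N))} {j : ℕ}
    (h : ∀ ℓ, Sum.inr (j, ℓ) ∈ A) :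
    Measurable[drawsAlgebra ξ U A] fun ω => flatMask fun ℓ => U j ℓ ω := by
  refine @measurable_pi_lambda _ _ _ (drawsAlgebra ξ U A) _ _ fun p => ?_
  have h1 : Measurable[drawsAlgebra ξ U A] (U j p.1) :=
    (comap_measurable (U j p.1)).mono (le_biSup (drawAlgebra ξ U) (h p.1)) le_rfl
  exact (measurable_entry p.2.1 p.2.2).comp h1

/-- The state before iteration `t` depends only on the data drawn before iteration `t` and on the
masks of the periods started before iteration `t`. -/
lemma measurable_process (hγ : Measurable fun p : Params m n × Ξ => gradient (fun y => F y p.2) p.1)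
    (β : ℝ) (τ : ℕ) (η : ℝ) (x₀ : Params m n) (t : ℕ) :
    Measurable[drawsAlgebra ξ U (pastDraws N t {j | j * τ < t})]
      (fun ω => (process F β τ η x₀ ξ U t ω).x) ∧
    Measurable[drawsAlgebra ξ U (pastDraws N t {j | j * τ < t})]
      (fun ω => vec (process F β τ η x₀ ξ U t ω).M) := by
  induction t with
  | zero => exact ⟨@measurable_const _ _ _ (_) x₀, @measurable_const _ _ _ (_) (vec fun _ => 0)⟩
  | succ t ih =>
    have hsub : pastDraws N t {j | j * τ < t} ⊆ pastDraws N (t + 1) {j | j * τ < t + 1} := by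
      rintro (s | p) hi
      · exact Nat.lt_succ_of_lt hi
      · exact Nat.lt_succ_of_lt hi
    have hle := drawsAlgebra_mono (ξ := ξ) (U := U) hsub
    have hx := ih.1.mono hle le_rfl
    have hM := ih.2.mono hle le_rfl
    have hξ : Measurable[drawsAlgebra ξ U (pastDraws N (t + 1) {j | j * τ < t + 1})] (ξ t) :=
      measurable_data_drawsAlgebra (Nat.lt_succ_self t)
    have hu : Measurable[drawsAlgebra ξ U (pastDraws N (t + 1) {j | j * τ < t + 1})]
        fun ω => flatMask fun ℓ => U (t / τ) ℓ ω :=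
      measurable_mask_drawsAlgebra fun ℓ => Nat.lt_succ_of_le (Nat.div_mul_le_self t τ)
    generalize drawsAlgebra ξ U (pastDraws N (t + 1) {j | j * τ < t + 1}) = 𝒜 at hx hM hξ hu ⊢
    have hM' : Measurable[𝒜] fun ω => vec (process F β τ η x₀ ξ U (t + 1) ω).M := by
      simp only [vec_process_M_succ]
      exact measurable_maskMul.comp (hu.prodMk
        ((hM.const_smul (1 - β)).add ((hγ.comp (hx.prodMk hξ)).const_smul β)))
    refine ⟨?_, hM'⟩
    simp only [process_x_succ]
    exact hx.sub ((measurable_maskMul.comp (hu.prodMk hM')).const_smul η)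

end Measurability

section Sampling

variable [MeasurableSpace Ξ] [MeasurableSpace Ω] {D : Measure Ξ} {μ : Measure Ω}
  {F : Params m n → Ξ → ℝ} {σ : Fin N → ℝ}
  {ξ : ℕ → Ω → Ξ} {U : ℕ → (ℓ : Fin N) → Ω → Matrix (Fin (m ℓ)) (Fin (n ℓ)) ℝ}

lemma IsSampling.drawAlgebra_le (hs : IsSampling D k μ ξ U) (i : ℕ ⊕ (ℕ × Fin N)) :
    drawAlgebra ξ U i ≤ ‹MeasurableSpace Ω› := by
  rcases i with t | p
  · exact (hs.measurable_data t).comap_le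
  · exact (hs.measurable_mask p.1 p.2).comap_le

lemma IsSampling.drawsAlgebra_le (hs : IsSampling D k μ ξ U) (A : Set (ℕ ⊕ (ℕ × Fin N))) :
    drawsAlgebra ξ U A ≤ ‹MeasurableSpace Ω› :=
  iSup₂_le fun i _ => hs.drawAlgebra_le i

lemma IsSampling.indep_drawsAlgebra (hs : IsSampling D k μ ξ U) {A B : Set (ℕ ⊕ (ℕ × Fin N))}
    (h : Disjoint A B) : Indep (drawsAlgebra ξ U A) (drawsAlgebra ξ U B) μ :=
  indep_iSup_of_disjoint hs.drawAlgebra_le hs.indep h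

lemma IsSampling.indepFun_of_disjoint (hs : IsSampling D k μ ξ U)
    {A B : Set (ℕ ⊕ (ℕ × Fin N))} (h : Disjoint A B) {α α' : Type*} [MeasurableSpace α]
    [MeasurableSpace α'] {f : Ω → α} {f' : Ω → α'} (hf : Measurable[drawsAlgebra ξ U A] f)
    (hf' : Measurable[drawsAlgebra ξ U B] f') : IndepFun f f' μ :=
  (IndepFun_iff_Indep f f' μ).2 <| indep_of_indep_of_le_left
    (indep_of_indep_of_le_right (hs.indep_drawsAlgebra h) hf'.comap_le) hf.comap_le

lemma IsSampling.ae_isMask (hs : IsSampling D k μ ξ U) (j : ℕ) :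
    ∀ᵐ ω ∂μ, IsMask (flatMask fun ℓ => U j ℓ ω) := by
  have h1 : ∀ ℓ, ∀ᵐ ω ∂μ, U j ℓ ω ∈ sparseMasks (m ℓ) (n ℓ) (k ℓ) := by
    intro ℓ
    refine ae_of_ae_map (p := fun S => S ∈ sparseMasks (m ℓ) (n ℓ) (k ℓ))
      (hs.measurable_mask j ℓ).aemeasurable ?_
    rw [hs.law_mask]
    exact ae_cond_mem finite_sparseMasks.measurableSet
  filter_upwards [ae_all_iff.2 h1] with ω hω p using (hω p.1).1 p.2.1 p.2.2

variable [IsProbabilityMeasure μ]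

lemma IsSampling.isProbabilityMeasure_uniformOn (hs : IsSampling D k μ ξ U) (ℓ : Fin N) :
    IsProbabilityMeasure (uniformOn (sparseMasks (m ℓ) (n ℓ) (k ℓ))) := by
  rw [← hs.law_mask 0 ℓ]
  exact Measure.isProbabilityMeasure_map (hs.measurable_mask 0 ℓ).aemeasurable

lemma IsSampling.integral_mask (hs : IsSampling D k μ ξ U) (j : ℕ)
    (p : (ℓ : Fin N) × (Fin (m ℓ) × Fin (n ℓ))) :
    ∫ ω, flatMask (fun ℓ => U j ℓ ω) p ∂μ
      = (k p.1 : ℝ) / ((m p.1 : ℝ) * (n p.1 : ℝ)) := by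
  have := hs.isProbabilityMeasure_uniformOn p.1
  rw [← integral_entry_sparseMasks p.2.1 p.2.2, ← hs.law_mask j p.1,
    integral_map (hs.measurable_mask j p.1).aemeasurable
      (measurable_entry p.2.1 p.2.2).aestronglyMeasurable]
  rfl

/-- GoSare is an instance of masked momentum SGD. -/
theorem isMaskedMSGD [IsProbabilityMeasure D] (hF : IsLoss F D)
    (hbdd : BddBelow (Set.range (objective F D))) {L : ℝ} (hL : LSmooth (objective F D) L)
    (hG : StochasticGradient F D σ) (hs : IsSampling D k μ ξ U)
    (β : ℝ) (τ : ℕ) (η : ℝ) (x₀ : Params m n) :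
    IsMaskedMSGD D μ (objective F D) (gradient (objective F D))
      (fun x s => gradient (fun y => F y s) x) L (totalNoise σ ^ 2) (minDensity m n k)
      (⨅ x, objective F D x) β η τ x₀ ξ (fun j ω => flatMask fun ℓ => U j ℓ ω)
      (fun t ω => (process F β τ η x₀ ξ U t ω).x)
      (fun t ω => vec (process F β τ η x₀ ξ U t ω).M) where
  lipschitz := hL.lipschitz
  quadratic := le_quadratic_of_lipschitz_gradient hL.differentiable hL.lipschitz
  bounded_below := ciInf_le hbdd
  measurable_f := hL.differentiable.continuous.measurable
  measurable_γ := hF.measurable_gradient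
  integrable_γ := hG.integrable_gradient hF
  integral_γ := hG.integral_gradient hF
  integrable_sq := hG.integrable_norm_sq
  variance_le := hG.integral_norm_sq_le
  measurable_ξ := hs.measurable_data
  measurable_u := fun j => (measurable_mask_drawsAlgebra (A := Set.univ) (ξ := ξ)
    fun _ => Set.mem_univ _).mono (hs.drawsAlgebra_le _) le_rfl
  measurable_X := fun t => (measurable_process hF.measurable_gradient β τ η x₀ t).1.mono
    (hs.drawsAlgebra_le _) le_rfl
  measurable_M := fun t => (measurable_process hF.measurable_gradient β τ η x₀ t).2.mono
    (hs.drawsAlgebra_le _) le_rfl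
  law_ξ := hs.law_data
  isMask := hs.ae_isMask
  mask_mean := fun j p => by
    rw [hs.integral_mask]
    exact minDensity_le k p.1
  X_zero := fun _ => rfl
  M_zero := fun _ => rfl
  M_succ := vec_process_M_succ F β τ η x₀ ξ U
  X_succ := process_x_succ F β τ η x₀ ξ U
  indep_ξ := fun t => by
    -- The non-strict j * τ ≤ t admits the mask drawn in iteration t itself, because it belongs to
    -- the state from which ξ t must be independent.
    have hsub : pastDraws N t {j | j * τ < t} ⊆ pastDraws N t {j | j * τ ≤ t} := by
      rintro (s | p) hi
      · exact hi
      · exact le_of_lt (show p.1 * τ < t from hi)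
    have hle := drawsAlgebra_mono (ξ := ξ) (U := U) hsub
    obtain ⟨hx, hM⟩ := measurable_process (ξ := ξ) (U := U) hF.measurable_gradient β τ η x₀ t
    have hu : Measurable[drawsAlgebra ξ U (pastDraws N t {j | j * τ ≤ t})]
        fun ω => flatMask fun ℓ => U (t / τ) ℓ ω :=
      measurable_mask_drawsAlgebra fun ℓ => Nat.div_mul_le_self t τ
    refine hs.indepFun_of_disjoint (A := pastDraws N t {j | j * τ ≤ t}) (B := {Sum.inl t}) ?_
      ((hx.mono hle le_rfl).prodMk ((hM.mono hle le_rfl).prodMk hu))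
      (measurable_data_drawsAlgebra (Set.mem_singleton _))
    exact Set.disjoint_singleton_right.2 fun hi => lt_irrefl t hi
  indep_u := fun j p => by
    have hx := (measurable_process (ξ := ξ) (U := U) hF.measurable_gradient β τ η x₀ (j * τ)).1
    have hu : Measurable[drawsAlgebra ξ U {i | ∃ ℓ, i = Sum.inr (j, ℓ)}]
        fun ω => flatMask fun ℓ => U j ℓ ω :=
      measurable_mask_drawsAlgebra fun ℓ => ⟨ℓ, rfl⟩
    -- The iterate at j * τ involves only masks i with i * τ < j * τ; the strict inequality excludes
    -- draw j.
    refine hs.indepFun_of_disjoint ?_ hx ((measurable_pi_apply p).comp hu)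
    rw [Set.disjoint_left]
    rintro i hi ⟨ℓ, rfl⟩
    exact lt_irrefl (j * τ) hi

end Sampling

end GoSare

/-! ### Rates for GoSare and the theorem -/

namespace GoSare

open MeasureTheory ProbabilityTheory

variable {N : ℕ} {m n k : Fin N → ℕ} {Ξ Ω : Type*} [MeasurableSpace Ξ] [MeasurableSpace Ω]
  {D : Measure Ξ} {μ : Measure Ω} [IsProbabilityMeasure D] [IsProbabilityMeasure μ]
  {F : Params m n → Ξ → ℝ} {σ : Fin N → ℝ} {L : ℝ} {x₀ : Params m n}
  {ξ : ℕ → Ω → Ξ} {U : ℕ → (ℓ : Fin N) → Ω → Matrix (Fin (m ℓ)) (Fin (n ℓ)) ℝ}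

lemma integrable_gradSq (hF : IsLoss F D)
    (hbdd : BddBelow (Set.range (objective F D))) (hLs : LSmooth (objective F D) L)
    (hG : StochasticGradient F D σ) (hs : IsSampling D k μ ξ U) (β : ℝ) (τ : ℕ) (η : ℝ) (t : ℕ) :
    Integrable (gradSq F D x₀ ξ U β τ η t) μ :=
  (isMaskedMSGD hF hbdd hLs hG hs β τ η x₀).integrable_grad t

/-- The sum of the expected squared gradient norms of GoSare over `K` periods. -/
theorem sum_integral_gradSq_le (hN : 0 < N) (hk : ∀ ℓ, 1 ≤ k ℓ) (hk' : ∀ ℓ, k ℓ ≤ m ℓ * n ℓ)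
    (hF : IsLoss F D) (hbdd : BddBelow (Set.range (objective F D))) (hL : 0 < L)
    (hLs : LSmooth (objective F D) L) (hG : StochasticGradient F D σ) (hs : IsSampling D k μ ξ U)
    {β : ℝ} {τ : ℕ} {η : ℝ} (hβ : 0 < β) (hβ1 : β ≤ 1)
    (hτ : 64 / (3 * β * minDensity m n k) ≤ (τ : ℝ)) (hη : 0 < η) (hη1 : η ≤ 1 / (4 * L))
    (hη2 : η ≤ √(3 * minDensity m n k * β ^ 2 / (80 * L ^ 2)))
    (hη3 : η ≤ √(3 * minDensity m n k / (80 * (τ : ℝ) ^ 2 * L ^ 2))) {K : ℕ} (hK : 1 ≤ K) :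
    ∑ t ∈ Finset.range (K * τ), ∫ ω, gradSq F D x₀ ξ U β τ η t ω ∂μ
      ≤ 16 * gap (objective F D) x₀ / (minDensity m n k * η)
        + 32 * β * totalNoise σ ^ 2 / (3 * minDensity m n k) * (K * τ) := by
  obtain ⟨hδ, hδ1⟩ := minDensity_pos_le_one hN hk hk'
  have hτ0 : (0 : ℝ) < τ := lt_of_lt_of_le (by positivity) hτ
  rw [le_div_iff₀ (by positivity)] at hη1
  rw [Real.le_sqrt' hη, le_div_iff₀ (by positivity)] at hη2 hη3
  exact (isMaskedMSGD hF hbdd hLs hG hs β τ η x₀).sum_integral_grad_le hβ hβ1 hδ hδ1 hη hL hτ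
    (by linarith) (by linarith) (by linarith) hK

/-- The rate of GoSare with the tuned hyperparameters. -/
theorem average_integral_gradSq_tuned_le (hN : 0 < N) (hk : ∀ ℓ, 1 ≤ k ℓ)
    (hk' : ∀ ℓ, k ℓ ≤ m ℓ * n ℓ)
    (hF : IsLoss F D) (hbdd : BddBelow (Set.range (objective F D))) (hL : 0 < L)
    (hLs : LSmooth (objective F D) L) (hG : StochasticGradient F D σ) (hs : IsSampling D k μ ξ U)
    {δ σtot Δ : ℝ} (hδ_def : δ = minDensity m n k) (hσ_def : σtot = totalNoise σ)
    (hΔ_def : Δ = gap (objective F D) x₀) (hΔ : 0 < Δ) {T : ℕ}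
    (hT : minIterations δ σtot L Δ ≤ (T : ℝ)) :
    1 / (T : ℝ) * ∑ t ∈ Finset.range T, ∫ ω, gradSq F D x₀ ξ U (tunedBeta δ σtot L Δ T)
        (tunedTau δ σtot L Δ T) (tunedEta δ σtot L Δ T) t ω ∂μ
      ≤ 2600 * (L * Δ / (δ ^ (5 / 2 : ℝ) * T)
        + √(L * Δ * σtot ^ 2 / (δ ^ (7 / 2 : ℝ) * T))) := by
  obtain ⟨hδ, hδ1⟩ := minDensity_pos_le_one hN hk hk'
  rw [← hδ_def] at hδ hδ1
  have hσ : 0 < σtot := by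
    have : Nonempty (Fin N) := ⟨⟨0, hN⟩⟩
    rw [hσ_def, totalNoise]
    exact Real.sqrt_pos.2 (Finset.sum_pos (fun ℓ _ => pow_pos (hG.sigma_pos ℓ) 2)
      Finset.univ_nonempty)
  have hT0 : (0 : ℝ) < T := by linarith [two_le_minIterations (σ := σtot) hδ hL hΔ]
  have hTn : 0 < T := by exact_mod_cast hT0
  refine le_trans ?_ (tuned_bound_le hδ hδ1 hσ hL hΔ T hTn)
  obtain ⟨hβ, hβ1⟩ := tunedBeta_pos_le (δ := δ) (σ := σtot) (L := L) (Δ := Δ) T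
  obtain ⟨hη, hη1, hη2, hη3, -⟩ := tunedEta_le (σ := σtot) (Δ := Δ) hδ hL T
  have hτ := le_tunedTau (δ := δ) (σ := σtot) (L := L) (Δ := Δ) T
  have hτT := tunedTau_le hδ hL hΔ T hT
  set β := tunedBeta δ σtot L Δ T
  set τ := tunedTau δ σtot L Δ T
  set η := tunedEta δ σtot L Δ T
  have hτ0 : (0 : ℝ) < τ := lt_of_lt_of_le (by positivity) hτ
  have hτn : 0 < τ := by exact_mod_cast hτ0
  -- enough full periods to cover `T` iterations
  have hTK : T ≤ (T / τ + 1) * τ := by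
    rw [add_mul, one_mul]
    exact (Nat.lt_div_mul_add hτn).le
  -- As τ ≤ T, rounding up to full periods at most doubles the number of iterations; hence 64/3
  -- instead of 32/3 in the noise term.
  have hK2 : (T / τ + 1) * τ ≤ 2 * T := by
    have := Nat.div_mul_le_self T τ
    rw [add_mul, one_mul]
    omega
  have hK2' : (((T / τ + 1 : ℕ) : ℝ) * τ) ≤ 2 * T := by exact_mod_cast hK2
  rw [hδ_def] at hτ hη2 hη3
  have hsum := sum_integral_gradSq_le (x₀ := x₀) hN hk hk' hF hbdd hL hLs hG hs hβ hβ1 hτ hη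
    hη1 hη2 hη3 (K := T / τ + 1) (Nat.le_add_left 1 _)
  rw [← hδ_def, ← hσ_def, ← hΔ_def] at hsum
  have hmono : ∑ t ∈ Finset.range T, ∫ ω, gradSq F D x₀ ξ U β τ η t ω ∂μ
      ≤ ∑ t ∈ Finset.range ((T / τ + 1) * τ), ∫ ω, gradSq F D x₀ ξ U β τ η t ω ∂μ :=
    Finset.sum_le_sum_of_subset_of_nonneg (Finset.range_mono hTK)
      fun _ _ _ => integral_nonneg fun _ => sq_nonneg _
  have hnoise : 32 * β * σtot ^ 2 / (3 * δ) * (((T / τ + 1 : ℕ) : ℝ) * τ)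
      ≤ 32 * β * σtot ^ 2 / (3 * δ) * (2 * T) := by gcongr
  calc 1 / (T : ℝ) * ∑ t ∈ Finset.range T, ∫ ω, gradSq F D x₀ ξ U β τ η t ω ∂μ
      ≤ 1 / (T : ℝ) * (16 * Δ / (δ * η) + 32 * β * σtot ^ 2 / (3 * δ) * (2 * T)) := by
        gcongr; linarith
    _ = _ := by field_simp; ring

end GoSare

theorem mainTheorem8 :
    ∃ C : ℝ, 0 < C ∧
    ∀ (N : ℕ) (_ : 0 < N) (m n k : Fin N → ℕ)
      (_ : ∀ ℓ, 1 ≤ k ℓ) (_ : ∀ ℓ, k ℓ ≤ m ℓ * n ℓ)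
      (Ξ : Type*) [MeasurableSpace Ξ] (D : MeasureTheory.Measure Ξ)
      [MeasureTheory.IsProbabilityMeasure D]
      (F : GoSare.Params m n → Ξ → ℝ) (_ : GoSare.IsLoss F D)
      (_ : BddBelow (Set.range (GoSare.objective F D)))
      (L : ℝ) (_ : 0 < L) (_ : GoSare.LSmooth (GoSare.objective F D) L)
      (σ : Fin N → ℝ) (_ : GoSare.StochasticGradient F D σ)
      (x₀ : GoSare.Params m n)
      (Ω : Type*) [MeasurableSpace Ω] (μ : MeasureTheory.Measure Ω)
      [MeasureTheory.IsProbabilityMeasure μ]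
      (ξ : ℕ → Ω → Ξ) (U : ℕ → (ℓ : Fin N) → Ω → Matrix (Fin (m ℓ)) (Fin (n ℓ)) ℝ)
      (_ : GoSare.IsSampling D k μ ξ U)
      (δ σtot Δ : ℝ) (_ : δ = GoSare.minDensity m n k) (_ : σtot = GoSare.totalNoise σ)
      (_ : Δ = GoSare.gap (GoSare.objective F D) x₀),
      -- the bound for general hyperparameters
      (∀ (β : ℝ) (τ : ℕ) (η : ℝ), 0 < β → β ≤ 1 → 64 / (3 * β * δ) ≤ (τ : ℝ) →
        0 < η → η ≤ 1 / (4 * L) → η ≤ √(3 * δ * β ^ 2 / (80 * L ^ 2)) →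
        η ≤ √(3 * δ / (80 * (τ : ℝ) ^ 2 * L ^ 2)) → η ≤ √(3 * β / (16 * (τ : ℝ) * L ^ 2)) →
        (∀ t, MeasureTheory.Integrable (GoSare.gradSq F D x₀ ξ U β τ η t) μ) ∧
        ∀ K : ℕ, 1 ≤ K →
          1 / ((K : ℝ) * (τ : ℝ)) * ∑ t ∈ Finset.range (K * τ), ∫ ω, GoSare.gradSq F D x₀ ξ U β τ η t ω ∂μ
            ≤ 16 * Δ / (δ * η * (K : ℝ) * (τ : ℝ)) + 32 * β * σtot ^ 2 / (3 * δ)) ∧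
      -- the rate for the tuned hyperparameters
      (0 < Δ → ∀ (T : ℕ), GoSare.minIterations δ σtot L Δ ≤ (T : ℝ) →
        ∀ (β : ℝ) (τ : ℕ) (η : ℝ), β = GoSare.tunedBeta δ σtot L Δ T →
        τ = GoSare.tunedTau δ σtot L Δ T → η = GoSare.tunedEta δ σtot L Δ T →
        (∀ t, MeasureTheory.Integrable (GoSare.gradSq F D x₀ ξ U β τ η t) μ) ∧
        1 / (T : ℝ) * ∑ t ∈ Finset.range T, ∫ ω, GoSare.gradSq F D x₀ ξ U β τ η t ω ∂μ
          ≤ C * (L * Δ / (δ ^ (5 / 2 : ℝ) * T)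
              + √(L * Δ * σtot ^ 2 / (δ ^ (7 / 2 : ℝ) * T)))) ∧
      -- the number of stochastic gradient evaluations that suffices for accuracy `ε`
      (0 < Δ → ∀ ε : ℝ, 0 < ε → ∃ T₀ : ℕ,
        (∀ ω, ((GoSare.process F (GoSare.tunedBeta δ σtot L Δ T₀)
            (GoSare.tunedTau δ σtot L Δ T₀) (GoSare.tunedEta δ σtot L Δ T₀)
            x₀ ξ U T₀ ω).calls : ℝ)
          ≤ C * (L * Δ * σtot ^ 2 / (δ ^ (7 / 2 : ℝ) * ε ^ 2) + L * Δ / (δ ^ (5 / 2 : ℝ) * ε)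
              + σtot ^ 2 / (δ ^ (1 / 2 : ℝ) * L * Δ) + 1 / δ)) ∧
        ∀ T : ℕ, T₀ ≤ T → GoSare.minIterations δ σtot L Δ ≤ (T : ℝ) ∧
          ∀ (β : ℝ) (τ : ℕ) (η : ℝ), β = GoSare.tunedBeta δ σtot L Δ T →
          τ = GoSare.tunedTau δ σtot L Δ T → η = GoSare.tunedEta δ σtot L Δ T →
          1 / (T : ℝ) * ∑ t ∈ Finset.range T, ∫ ω, GoSare.gradSq F D x₀ ξ U β τ η t ω ∂μ ≤ ε ∧
          ∃ t < T, ∫ ω, GoSare.gradSq F D x₀ ξ U β τ η t ω ∂μ ≤ ε) := by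
  -- The rate needs only 2600; the complexity needs 4 * 2600², just above 2.7 * 10 ^ 7.
  refine ⟨3 * 10 ^ 7, by norm_num, ?_⟩
  intro N hN m n k hk hk' Ξ _ D _ F hF hbdd L hL hLs σ hG x₀ Ω _ μ _ ξ U hs δ σtot Δ hδ_def hσ_def
    hΔ_def
  obtain ⟨hδ, hδ1⟩ := GoSare.minDensity_pos_le_one hN hk hk'
  have hint := GoSare.integrable_gradSq (x₀ := x₀) hF hbdd hLs hG hs
  refine ⟨?_, ?_, ?_⟩
  · intro β τ η hβ hβ1 hτ hη hη1 hη2 hη3 _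
    refine ⟨hint β τ η, fun K hK => ?_⟩
    rw [hδ_def] at hτ hη2 hη3
    have hτ0 : (0 : ℝ) < τ := lt_of_lt_of_le (by positivity) hτ
    have hK0 : (0 : ℝ) < K := by exact_mod_cast hK
    have hsum := GoSare.sum_integral_gradSq_le (x₀ := x₀) hN hk hk' hF hbdd hL hLs hG hs hβ hβ1
      hτ hη hη1 hη2 hη3 hK
    rw [← hδ_def, ← hσ_def, ← hΔ_def] at hsum
    rw [← hδ_def] at hδ
    refine (mul_le_mul_of_nonneg_left hsum (by positivity)).trans_eq ?_
    field_simp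
  · rintro hΔ T hT β τ η rfl rfl rfl
    refine ⟨hint _ _ _, (GoSare.average_integral_gradSq_tuned_le hN hk hk' hF hbdd hL hLs hG hs
      hδ_def hσ_def hΔ_def hΔ hT).trans ?_⟩
    rw [← hδ_def] at hδ
    exact mul_le_mul_of_nonneg_right (by norm_num) (by positivity)
  · intro hΔ ε hε
    rw [← hδ_def] at hδ hδ1
    obtain ⟨T₀, hT₀, hT⟩ := GoSare.exists_iterations (σ := σtot) hδ hδ1 hL hΔ hε
    refine ⟨T₀, fun ω => ?_, fun T hTT => ⟨(hT T hTT).1, ?_⟩⟩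
    · rwa [GoSare.process_calls]
    · rintro β τ η rfl rfl rfl
      have havg := (GoSare.average_integral_gradSq_tuned_le hN hk hk' hF hbdd hL hLs hG hs
        hδ_def hσ_def hΔ_def hΔ (hT T hTT).1).trans (hT T hTT).2
      refine ⟨havg, ?_⟩
      have hT0 : (0 : ℝ) < T := by
        linarith [GoSare.two_le_minIterations (σ := σtot) hδ hL hΔ, (hT T hTT).1]
      -- If all T terms exceeded ε, so would their average.
      by_contra! hcon
      have hlt := Finset.sum_lt_sum_of_nonempty
        (Finset.nonempty_range_iff.2 (Nat.cast_pos.1 hT0).ne')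
        fun t ht => hcon t (Finset.mem_range.1 ht)
      rw [Finset.sum_const, Finset.card_range, nsmul_eq_mul] at hlt
      rw [one_div, inv_mul_le_iff₀ hT0] at havg
      linarith
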